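/- Let $F=\mathbb F_q$ be a finite field with $q$ elements, let $n\ge 1$ and $r\ge 0$ be integers, and put $G=GL_n(F)$. Let $P\subseteq G$ be the subgroup of block upper triangular matrices with diagonal blocks of sizes $1$ and $n-1$, let $L=GL_1(F)\times GL_{n-1}(F)$ be its block diagonal subgroup and $U$ its unipotent radical, and let $e_U=\frac1{|U|}\sum_{u\in U}u\in\mathbb CG$. For a complex $G$-module $V$ let $\mathrm{Resf}(V)=e_UV$, an $L$-module; for an $L$-module $V$ let $\mathrm{Indf}(V)=\mathbb CG\otimes_{\mathbb CP}V$, where $P$ acts on $V$ through $P\to P/U\cong L$. With $\mathbf 1$ the trivial $G$-module, define $$W_q^r=(\mathrm{Indf}\,\mathrm{Resf})^r(\mathbf 1),\qquad W_q^{r+1/2}=\mathrm{Resf}\,(\mathrm{Indf}\,\mathrm{Resf})^r(\mathbf 1),$$ and for $x\in\mathbb CG$ write $x\otimes_U v=x\otimes e_Uv$. Identify $W_q^{r+1/2}=e_UW_q^r$ with its image in $W_q^{r+1}$ under the injective map $v\mapsto 1\otimes v$. For integers $0\le k_1,\dots,k_r\le n-1$ put $k_1^*=0$ and $k_j^*=\min\{k_j,\max\{k_1^*+1,\dots,k_{j-1}^*+1\}\}$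 for $j>1$. The set $\mathcal P_{n\times r}(q)$ of $n$-restricted $q$-set partitions of $\{1,\dots,r\}$ consists of the sequences $K=((k_1,a^{(1)}),\dots,(k_r,a^{(r)}))$ with $0\le k_j\le n-1$ and $a^{(j)}\in F^{k_j-k_j^*}$. Let $s_i(c)=x_{i,i+1}(c)s_i\in G$, where $x_{i,i+1}(c)$ is the matrix with ones on the diagonal, $c$ in position $(i,i+1)$ and zeros elsewhere, and $s_i$ is the permutation matrix switching $i$ and $i+1$. To a column $(k,a)$ with $\ast$-height $k^*$ attach $$\overset{\ast}{w}_{k}(a)=s_k(a_{k-k^*})\cdots s_{k^*+1}(a_1)\;\frac1{q^{k^*}}\sum_{b\in F^{k^*}}s_{k^*}(b_{k^*})\cdots s_1(b_1)\in\mathbb CG,$$ and put $v_K=\overset{\ast}{w}_{k_1}(a^{(1)})\otimes_U\cdots\otimes_U\overset{\ast}{w}_{k_r}(a^{(r)})\otimes_U 1\in W_q^r$. Let $[i]=1+q+\cdots+q^{i-1}$, let $S(r,\ell)$ be the Stirling numbers of the second kind, and let $d_{n,r}(q)=\sum_{\ell=0}^{n}S(r,\ell)\,[n][n-1]\cdots[n-\ell+1]$.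 Theorem. (a) The family $(v_K)_{K\in\mathcal P_{n\times r}(q)}$ is a basis of $W_q^r$ over $\mathbb C$, and $\dim W_q^r=d_{n,r}(q)$. (b) The family $(v_K)$, indexed by the $K\in\mathcal P_{n\times(r+1)}(q)$ with $k_1=0$, is a basis of $W_q^{r+1/2}$ over $\mathbb C$, where $v_K\in W_q^{r+1}$ corresponds under the identification above to the vector $e_U\big(\overset{\ast}{w}_{k_2}(a^{(2)})\otimes_U\cdots\otimes_U\overset{\ast}{w}_{k_{r+1}}(a^{(r+1)})\otimes_U 1\big)$ of $W_q^{r+1/2}$; and $\dim W_q^{r+1/2}=d_{n,r+1}(q)/[n]$. -/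

import Mathlib

open scoped MatrixGroups

noncomputable section

namespace QPartition

universe u

/-! ### The groups `G = GL_n(F)`, `P`, `L`, `U` (row and column numbers start at `0`) -/

section Groups

variable (n : ℕ) [NeZero n] (F : Type u) [Field F]

/-- The parabolic subgroup `P` of block upper triangular matrices with diagonal blocks
of sizes `1` and `n - 1`. -/
def parabolic : Subgroup (GL (Fin n) F) where
  carrier := {g | ∀ i, i ≠ 0 → g.val i 0 = 0}
  one_mem' := fun i hi => by simp [hi]
  mul_mem' := by
    intro a b ha hb i hi
    rw [Units.val_mul, Matrix.mul_apply]
    refine Finset.sum_eq_zero fun k _ => ?_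
    by_cases hk : k = 0
    · subst hk; rw [ha i hi, zero_mul]
    · rw [hb k hk, mul_zero]
  inv_mem' := by
    intro g hg
    have key : ∀ i, g⁻¹.val i 0 * g.val 0 0 = (1 : Matrix (Fin n) (Fin n) F) i 0 := by
      intro i
      have h : (g⁻¹.val * g.val) i 0 = (1 : Matrix (Fin n) (Fin n) F) i 0 := by
        rw [← Units.val_mul, inv_mul_cancel, Units.val_one]
      rw [Matrix.mul_apply, Finset.sum_eq_single 0] at h
      · exact h
      · intro k _ hk; rw [hg k hk, mul_zero]
      · simp
    have h0 : g.val 0 0 ≠ 0 := by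
      intro h
      have := key 0
      simp [h] at this
    intro i hi
    have := key i
    rw [Matrix.one_apply_ne hi] at this
    exact (mul_eq_zero.mp this).resolve_right h0

/-- The Levi subgroup `L = G_1 × G_{n-1}` of block diagonal matrices with blocks of sizes
`1` and `n - 1`. -/
def levi : Subgroup (GL (Fin n) F) where
  carrier := {g | ∀ i j, ¬ (i = 0 ↔ j = 0) → g.val i j = 0}
  one_mem' := fun i j h => by
    have : i ≠ j := by rintro rfl; exact h Iff.rfl
    simp [this]
  mul_mem' := by
    intro a b ha hb i j hij
    rw [Units.val_mul, Matrix.mul_apply]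
    refine Finset.sum_eq_zero fun k _ => ?_
    by_cases hk : i = 0 ↔ k = 0
    · rw [hb k j (fun h => hij (hk.trans h)), mul_zero]
    · rw [ha i k hk, zero_mul]
  inv_mem' := by
    intro g hg
    have hgP : g ∈ parabolic n F := fun i hi => hg i 0 (by simp [hi])
    have hiP := (parabolic n F).inv_mem hgP
    have h0 : g.val 0 0 ≠ 0 := by
      intro h
      have h1 : (g.val * g⁻¹.val) 0 0 = (1 : Matrix (Fin n) (Fin n) F) 0 0 := by
        rw [← Units.val_mul, mul_inv_cancel, Units.val_one]
      rw [Matrix.mul_apply, Finset.sum_eq_zero] at h1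
      · simp at h1
      · intro k _
        by_cases hk : k = 0
        · subst hk; rw [h, zero_mul]
        · rw [hiP k hk, mul_zero]
    intro i j hij
    by_cases hi : i = 0
    · subst hi
      have hj : j ≠ 0 := fun h => hij (by simp [h])
      have h1 : (g.val * g⁻¹.val) 0 j = (1 : Matrix (Fin n) (Fin n) F) 0 j := by
        rw [← Units.val_mul, mul_inv_cancel, Units.val_one]
      rw [Matrix.mul_apply, Finset.sum_eq_single 0, Matrix.one_apply_ne (Ne.symm hj)] at h1
      · exact (mul_eq_zero.mp h1).resolve_left h0
      · intro k _ hk; rw [hg 0 k (by simp [hk]), zero_mul]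
      · simp
    · have hj : j = 0 := by by_contra hj; exact hij (by simp [hi, hj])
      subst hj
      exact hiP i hi

/-- The unipotent radical `U` of `P`: matrices that agree with the identity matrix except
possibly in the entries `(0, j)` with `j ≠ 0`. -/
def unip : Subgroup (GL (Fin n) F) where
  carrier := {g | ∀ i j, (i ≠ 0 ∨ j = 0) → g.val i j = (1 : Matrix (Fin n) (Fin n) F) i j}
  one_mem' := fun i j _ => by simp
  mul_mem' := by
    intro a b ha hb i j hij
    rw [Units.val_mul, Matrix.mul_apply, Finset.sum_eq_single i]
    · by_cases hi : i = 0
      · subst hi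
        rw [ha 0 0 (Or.inr rfl), Matrix.one_apply_eq, one_mul, hb 0 j hij]
      · rw [ha i i (Or.inl hi), Matrix.one_apply_eq, one_mul, hb i j hij]
    · intro k _ hk
      by_cases hi : i = 0
      · subst hi
        have hj : j = 0 := hij.resolve_left (by simp)
        subst hj
        rw [hb k 0 (Or.inr rfl), Matrix.one_apply_ne hk, mul_zero]
      · rw [ha i k (Or.inl hi), Matrix.one_apply_ne (Ne.symm hk), zero_mul]
    · simp
  inv_mem' := by
    intro g hg i j hij
    have hgP : g ∈ parabolic n F := fun k hk => by
      rw [hg k 0 (Or.inl hk), Matrix.one_apply_ne hk]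
    have hiP := (parabolic n F).inv_mem hgP
    by_cases hi : i = 0
    · have hj : j = 0 := hij.resolve_left (by simp [hi])
      subst hi hj
      have h1 : (g⁻¹.val * g.val) 0 0 = (1 : Matrix (Fin n) (Fin n) F) 0 0 := by
        rw [← Units.val_mul, inv_mul_cancel, Units.val_one]
      rw [Matrix.mul_apply, Finset.sum_eq_single 0, hg 0 0 (Or.inr rfl), Matrix.one_apply_eq,
        mul_one] at h1
      · rw [h1, Matrix.one_apply_eq]
      · intro k _ hk; rw [hgP k hk, mul_zero]
      · simp
    · have h1 : (g.val * g⁻¹.val) i j = (1 : Matrix (Fin n) (Fin n) F) i j := by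
        rw [← Units.val_mul, mul_inv_cancel, Units.val_one]
      rw [Matrix.mul_apply, Finset.sum_eq_single i, hg i i (Or.inl hi), Matrix.one_apply_eq,
        one_mul] at h1
      · exact h1
      · intro k _ hk
        rw [hg i k (Or.inl hi), Matrix.one_apply_ne (Ne.symm hk), zero_mul]
      · simp

variable {n F}

/-- The block diagonal part of a matrix, for the blocks of sizes `1` and `n - 1`. -/
def blockDiagPart (M : Matrix (Fin n) (Fin n) F) : Matrix (Fin n) (Fin n) F :=
  Matrix.of fun i j => if (i = 0 ↔ j = 0) then M i j else 0

theorem blockDiagPart_one : blockDiagPart (1 : Matrix (Fin n) (Fin n) F) = 1 := by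
  ext i j
  simp only [blockDiagPart, Matrix.of_apply]
  split_ifs with h
  · rfl
  · rw [Matrix.one_apply_ne]
    rintro rfl
    exact h Iff.rfl

theorem blockDiagPart_mul (M N : Matrix (Fin n) (Fin n) F)
    (hM : ∀ i, i ≠ 0 → M i 0 = 0) (hN : ∀ i, i ≠ 0 → N i 0 = 0) :
    blockDiagPart (M * N) = blockDiagPart M * blockDiagPart N := by
  ext i j
  simp only [blockDiagPart, Matrix.of_apply, Matrix.mul_apply]
  split_ifs with h
  · refine Finset.sum_congr rfl fun k _ => ?_
    by_cases hik : i = 0 ↔ k = 0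
    · rw [if_pos hik, if_pos (hik.symm.trans h)]
    · rw [if_neg hik, zero_mul]
      by_cases hi : i = 0
      · have hk : k ≠ 0 := fun hk => hik (by simp [hi, hk])
        rw [h.mp hi, hN k hk, mul_zero]
      · have hk : k = 0 := by by_contra hk; exact hik (by simp [hi, hk])
        rw [hk, hM i hi, zero_mul]
  · symm
    refine Finset.sum_eq_zero fun k _ => ?_
    by_cases hik : i = 0 ↔ k = 0
    · rw [if_neg (fun hkj => h (hik.trans hkj)), mul_zero]
    · rw [if_neg hik, zero_mul]

variable (n F)

/-- The surjection `P → P/U ≅ L` that sends a block upper triangular matrix to its block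
diagonal part. -/
def toLevi : parabolic n F →* levi n F where
  toFun p :=
    ⟨{ val := blockDiagPart p.val.val
       inv := blockDiagPart p⁻¹.val.val
       val_inv := by
        rw [← blockDiagPart_mul _ _ p.2 (p⁻¹).2, ← Units.val_mul, ← Subgroup.coe_mul,
          mul_inv_cancel]
        exact blockDiagPart_one
       inv_val := by
        rw [← blockDiagPart_mul _ _ (p⁻¹).2 p.2, ← Units.val_mul, ← Subgroup.coe_mul,
          inv_mul_cancel]
        exact blockDiagPart_one },
      fun i j hij => by simp [blockDiagPart, hij]⟩
  map_one' := Subtype.ext <| Units.ext blockDiagPart_one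
  map_mul' p q := Subtype.ext <| Units.ext <| blockDiagPart_mul _ _ p.2 q.2

variable {n F}

theorem levi_conj_unip {l u : GL (Fin n) F} (hl : l ∈ levi n F) (hu : u ∈ unip n F) :
    l * u * l⁻¹ ∈ unip n F := by
  have hli := (levi n F).inv_mem hl
  have key : ∀ i j, (i ≠ 0 ∨ j = 0) → (l * u).val i j = l.val i j := by
    intro i j hij
    rw [Units.val_mul, Matrix.mul_apply, Finset.sum_eq_single j]
    · by_cases hj : j = 0
      · rw [hu j j (Or.inr hj), Matrix.one_apply_eq, mul_one]
      · rw [hu j j (Or.inl hj), Matrix.one_apply_eq, mul_one]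
    · intro k _ hk
      by_cases hk0 : k = 0
      · by_cases hj : j = 0
        · exact absurd (hk0.trans hj.symm) hk
        · rw [hl i k (by simp [hij.resolve_right hj, hk0]), zero_mul]
      · rw [hu k j (Or.inl hk0), Matrix.one_apply_ne hk, mul_zero]
    · simp
  intro i j hij
  have h1 : (l * u * l⁻¹).val i j = (l * l⁻¹).val i j := by
    rw [Units.val_mul (l * u), Units.val_mul l l⁻¹, Matrix.mul_apply, Matrix.mul_apply]
    refine Finset.sum_congr rfl fun k _ => ?_
    by_cases h : i ≠ 0 ∨ k = 0
    · rw [key i k h]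
    · push Not at h
      have hj : j = 0 := hij.resolve_left (by simp [h.1])
      rw [hli k j (by simp [h.2, hj]), mul_zero, mul_zero]
  rw [h1, mul_inv_cancel, Units.val_one]

end Groups

/-! ### Harish-Chandra restriction and induction -/

section HarishChandra

variable (n : ℕ) [NeZero n] (F : Type u) [Field F] [Fintype F]

instance : Fintype (unip n F) := Fintype.ofFinite _

/-- The idempotent `e_U = |U|⁻¹ ∑_{u ∈ U} u` of the group algebra `ℂG`. -/
def eU : MonoidAlgebra ℂ (GL (Fin n) F) :=
  (Fintype.card (unip n F) : ℂ)⁻¹ • ∑ u : unip n F, MonoidAlgebra.of ℂ (GL (Fin n) F) u.val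

variable {n F}

theorem levi_mul_eU (l : levi n F) :
    MonoidAlgebra.of ℂ (GL (Fin n) F) l.val * eU n F =
      eU n F * MonoidAlgebra.of ℂ (GL (Fin n) F) l.val := by
  rw [eU, mul_smul_comm, smul_mul_assoc, Finset.mul_sum, Finset.sum_mul]
  congr 1
  refine Finset.sum_bij' (fun u _ => ⟨l.val * u.val * l.val⁻¹, levi_conj_unip l.2 u.2⟩)
    (fun u _ => ⟨l.val⁻¹ * u.val * l.val, by
      simpa using levi_conj_unip ((levi n F).inv_mem l.2) u.2⟩) ?_ ?_ ?_ ?_ ?_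
  · simp
  · simp
  · intro u _; apply Subtype.ext; simp [mul_assoc]
  · intro u _; apply Subtype.ext; simp [mul_assoc]
  · intro u _; rw [← map_mul, ← map_mul]; simp [mul_assoc]

/-- The operator by which `e_U` acts on a `G`-module `V`. -/
def eUOp (V : Rep.{u} ℂ (GL (Fin n) F)) : V →ₗ[ℂ] V :=
  V.ρ.asAlgebraHom (eU n F)

theorem eUOp_comm (V : Rep.{u} ℂ (GL (Fin n) F)) (l : levi n F) (v : V) :
    V.ρ l.val (eUOp V v) = eUOp V (V.ρ l.val v) := by
  have h := congrArg (fun x => V.ρ.asAlgebraHom x v) (levi_mul_eU l)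
  simpa [eUOp, Module.End.mul_apply] using h

/-- Harish-Chandra restriction: the `L`-module `e_U V` attached to a `G`-module `V`. -/
def Resf (V : Rep.{u} ℂ (GL (Fin n) F)) : Rep.{u} ℂ (levi n F) :=
  Rep.of (X := LinearMap.range (eUOp V))
    { toFun := fun l => (V.ρ l.val).restrict (by
        rintro _ ⟨v, rfl⟩
        exact ⟨V.ρ l.val v, (eUOp_comm V l v).symm⟩)
      map_one' := by ext x; simp
      map_mul' := fun l m => by ext x; simp }

/-- The vector `e_U v` of `e_U V`. -/
def toResf (V : Rep.{u} ℂ (GL (Fin n) F)) : V →ₗ[ℂ] Resf V :=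
  (eUOp V).rangeRestrict

/-- Inflation: an `L`-module regarded as a `P`-module through `P → P/U ≅ L`. -/
def Infl (V : Rep.{u} ℂ (levi n F)) : Rep.{u} ℂ (parabolic n F) :=
  Rep.of (X := V) (V.ρ.comp (toLevi n F))

/-- Harish-Chandra induction: the `G`-module `ℂG ⊗_{ℂP} V`, where the `L`-module `V` is
inflated to `P`. -/
def Indf (V : Rep.{u} ℂ (levi n F)) : Rep.{u} ℂ (GL (Fin n) F) :=
  Rep.ind (parabolic n F).subtype (Infl V)

/-- The tensor `g ⊗ v` in `ℂG ⊗_{ℂP} V`, for `g ∈ G` and `v ∈ V`. The library realizes the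
induced module with `P` acting on `ℂG` by left multiplication and `h ∈ G` acting by right
multiplication by `h⁻¹`; this is turned into the usual convention by `g ↦ g⁻¹`,
see `smul_groupTmul` and `groupTmul_mul`. -/
def groupTmul (V : Rep.{u} ℂ (levi n F)) (g : GL (Fin n) F) : V →ₗ[ℂ] Indf V :=
  Representation.IndV.mk (parabolic n F).subtype (Infl V).ρ g⁻¹

theorem smul_groupTmul (V : Rep.{u} ℂ (levi n F)) (h g : GL (Fin n) F) (v : V) :
    (Indf V).ρ h (groupTmul V g v) = groupTmul V (h * g) v := by
  have := Representation.ind_mk (parabolic n F).subtype (Infl V).ρ h g⁻¹ v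
  rw [← mul_inv_rev] at this
  exact this

theorem groupTmul_mul (V : Rep.{u} ℂ (levi n F)) (g : GL (Fin n) F) (p : parabolic n F) (v : V) :
    groupTmul V (g * p.val) v = groupTmul V g (V.ρ (toLevi n F p) v) := by
  have h := Representation.Coinvariants.mk_inv_tmul
    ((Representation.leftRegular ℂ (GL (Fin n) F)).comp (parabolic n F).subtype) (Infl V).ρ
    (MonoidAlgebra.single g⁻¹ 1) v p
  simp only [MonoidHom.comp_apply, Representation.leftRegular, Representation.ofMulAction_single,
    Subgroup.subtype_apply] at h
  rw [groupTmul, mul_inv_rev]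
  exact h

/-- The tensor `x ⊗ v` in `ℂG ⊗_{ℂP} V`, for `x ∈ ℂG` and `v ∈ V`. -/
def algTmul (V : Rep.{u} ℂ (levi n F)) (x : MonoidAlgebra ℂ (GL (Fin n) F)) (v : V) : Indf V :=
  x.coeff.sum fun g c => c • groupTmul V g v

variable (n F)

/-- The `G`-module `IR^r = (Indf Resf)^r (1)`; `1` is the trivial module `ℂ` (lifted to the
universe of `F`). -/
def IR : ℕ → Rep.{u} ℂ (GL (Fin n) F)
  | 0 => Rep.trivial ℂ (GL (Fin n) F) (ULift.{u} ℂ)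
  | r + 1 => Indf (Resf (IR r))

/-- The `L`-module `IR^{r+1/2} = Resf (Indf Resf)^r (1)`. -/
def IRHalf (r : ℕ) : Rep.{u} ℂ (levi n F) := Resf (IR n F r)

variable {n F}

/-- The vector `x_1 ⊗_U x_2 ⊗_U ⋯ ⊗_U x_r ⊗_U 1` of `IR^r`, for `x_1, …, x_r ∈ ℂG`; here
`x ⊗_U v` is `x ⊗ e_U v`. -/
def iterTmul : (r : ℕ) → (Fin r → MonoidAlgebra ℂ (GL (Fin n) F)) → IR n F r
  | 0, _ => (ULift.up 1 : ULift.{u} ℂ)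
  | r + 1, x => algTmul (Resf (IR n F r)) (x 0)
      (toResf (IR n F r) (iterTmul r (Fin.tail x)))

/-- The map `v ↦ 1 ⊗ v` from `IR^{r+1/2}` to `IR^{r+1}`. -/
def halfIncl (r : ℕ) : IRHalf n F r →ₗ[ℂ] IR n F (r + 1) :=
  groupTmul (Resf (IR n F r)) 1

end HarishChandra

/-! ### `q`-set partitions -/

section QSetPartitions

/-- The `∗`-height of a sequence `k_1, …, k_r`:
`k_j^* = min (k_j, max {k_1^* + 1, …, k_{j-1}^* + 1})`, and `k_1^* = 0`
(the maximum over the empty set is `0`). -/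
def starHeight {r : ℕ} (k : Fin r → ℕ) (j : Fin r) : ℕ :=
  min (k j) (Finset.univ.sup fun i : Fin j.val => starHeight k ⟨i.val, i.2.trans j.2⟩ + 1)
termination_by j.val
decreasing_by exact i.2

theorem starHeight_le {r : ℕ} (k : Fin r → ℕ) (j : Fin r) : starHeight k j ≤ k j := by
  rw [starHeight]
  exact min_le_left _ _

/-- The set `𝒫_{n×r}(q)` of `n`-restricted `q`-set partitions of `{1, …, r}`: heights
`0 ≤ k_j ≤ n - 1` with labels `a^{(j)} ∈ F^{k_j - k_j^*}`, where `q = |F|`. -/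
@[ext]
structure QSetPartition (n r : ℕ) (F : Type u) where
  k : Fin r → Fin n
  a : (j : Fin r) → Fin ((k j).val - starHeight (fun i => (k i).val) j) → F

end QSetPartitions

/-! ### The vectors `v_K` -/

section Vectors

variable {n : ℕ} {F : Type u} [Field F]

/-- The matrix `x_{ij}(a)`, `i ≠ j`, with ones on the diagonal, `a` in position `(i, j)` and
zeros elsewhere. -/
def xElt (i j : Fin n) (hij : i ≠ j) (a : F) : GL (Fin n) F where
  val := Matrix.transvection i j a
  inv := Matrix.transvection i j (-a)
  val_inv := by rw [Matrix.transvection_mul_transvection_same i j hij]; simp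
  inv_val := by rw [Matrix.transvection_mul_transvection_same i j hij]; simp

/-- The element `s_{i+1}(a) = x_{i+1,i+2}(a) s_{i+1}` of `GL_n(F)`; since rows and columns are
numbered from `0` here, the simple reflection `s_{i+1}` switches `i` and `i + 1`. -/
def sElt (i : ℕ) (h : i + 1 < n) (a : F) : GL (Fin n) F :=
  xElt ⟨i, by omega⟩ ⟨i + 1, h⟩ (by simp) a *
    Matrix.GeneralLinearGroup.swap F ⟨i, by omega⟩ ⟨i + 1, h⟩

/-- The product `s_{l+m}(c_m) ⋯ s_{l+2}(c_2) s_{l+1}(c_1)`. -/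
def sProd (l : ℕ) : (m : ℕ) → l + m < n → (Fin m → F) → GL (Fin n) F
  | 0, _, _ => 1
  | m + 1, h, c => sElt (l + m) h (c (Fin.last m)) * sProd l m (by omega) (Fin.init c)

/-- The element of `ℂG` attached to a column of height `k` with `h` starred boxes and labels
`a_1, …, a_{k-h}`:
`s_k(a_{k-h}) ⋯ s_{h+1}(a_1) · q^{-h} ∑_{b ∈ F^h} s_h(b_h) ⋯ s_1(b_1)`. -/
def starW [Fintype F] (k : Fin n) (h : ℕ) (hk : h ≤ k.val) (a : Fin (k.val - h) → F) :
    MonoidAlgebra ℂ (GL (Fin n) F) :=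
  MonoidAlgebra.of ℂ (GL (Fin n) F) (sProd h (k.val - h) (by omega) a) *
    (((Fintype.card F : ℂ) ^ h)⁻¹ •
      ∑ b : Fin h → F, MonoidAlgebra.of ℂ (GL (Fin n) F) (sProd 0 h (by omega) b))

/-- The element of `ℂG` attached to the column `j` of `K`. -/
def QSetPartition.column [Fintype F] {r : ℕ} (K : QSetPartition n r F) (j : Fin r) :
    MonoidAlgebra ℂ (GL (Fin n) F) :=
  starW (K.k j) (starHeight (fun i => (K.k i).val) j)
    (starHeight_le (fun i => (K.k i).val) j) (K.a j)

/-- The vector `v_K ∈ IR^r` of a `q`-set partition `K`. -/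
def vec [NeZero n] [Fintype F] {r : ℕ} (K : QSetPartition n r F) : IR n F r :=
  iterTmul r K.column

/-- The vector `e_U (x_2 ⊗_U ⋯ ⊗_U x_{r+1} ⊗_U 1)` of `IR^{r+1/2}`, where `x_j ∈ ℂG` is attached
to the column `j` of `K`; the first column of `K`, meant to be empty, is omitted. -/
def vecHalf [NeZero n] [Fintype F] {r : ℕ} (K : QSetPartition n (r + 1) F) : IRHalf n F r :=
  toResf (IR n F r) (iterTmul r (Fin.tail K.column))

end Vectors

/-! ### The dimension -/

/-- The `q`-integer `[i] = 1 + q + ⋯ + q^{i-1}`. -/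
def qInt (q i : ℕ) : ℕ := ∑ j ∈ Finset.range i, q ^ j

/-- `d_{n,r}(q) = ∑_{ℓ=0}^{n} S(r,ℓ) [n][n-1]⋯[n-ℓ+1]`. -/
def d (n r q : ℕ) : ℕ :=
  ∑ l ∈ Finset.range (n + 1), Nat.stirlingSecond r l * ∏ i ∈ Finset.range l, qInt q (n - i)

end QPartition

end

/-!
For `0 ≤ h ≤ n` let `U_h` be the group of unitriangular matrices whose entries off the diagonal
lie in the first `h` rows, so that `U_0 = 1` and `U_1 = U`. By induction on `r`, for all `h` at
once, the averages over `U_h` of the vectors `v_K` form a basis of the `U_h`-fixed vectors of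
`IR^r`, where `K` runs over the `q`-set partitions whose `∗`-heights are computed as if columns with
maximal `∗`-height `h - 1` preceded them. The case `h = 0` is (a), and `h = 1` is (b).

For the inductive step, the double cosets `U_h \ G / P` are represented by the elements
`w = s_k(a_{k-l}) ⋯ s_{l+1}(a_1) s_l(0) ⋯ s_1(0)` with `l = min k h`, that is, by the possible first
columns of `K`: the first column of a matrix determines its class modulo `P`, and `U_h` clears the
labels in the first `h` rows. By Mackey's theorem the class of `w` contributes the vectors of
`e_U V` fixed by `P ∩ w⁻¹ U_h w`, where `V = IR^{r-1}`. As `(P ∩ w⁻¹ U_h w) U = U_{h'}` with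
`h' = max h (l + 1)`, these are the `U_{h'}`-fixed vectors of `V`.

For the dimensions, the number `N r h` of these partitions satisfies
`N (r + 1) h = h * N r h + [n - h] * N r (h + 1)`, the recursion behind the Stirling numbers.
-/

noncomputable section

namespace QPartition

universe u

/-! ### `q`-set partitions with an initial `∗`-height -/

section InitialHeight

/-- The initial `∗`-height of the columns that follow a first column of height `k`, when that
column itself has initial `∗`-height `h`. -/
def nextHeight (h k : ℕ) : ℕ := max h (min k h + 1)

/-- The `∗`-height with initial value `h`: `k_j^* = min (k_j, max {h, k_1^* + 1, …, k_{j-1}^* + 1})`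
(see `starHeightFrom_eq`). It is computed column by column, so that the remaining columns of a
sequence again form such a sequence with initial value `nextHeight h k_1`. -/
def starHeightFrom : ℕ → {r : ℕ} → (Fin r → ℕ) → Fin r → ℕ
  | _, 0, _ => Fin.elim0
  | h, _ + 1, k => Fin.cons (min (k 0) h) (starHeightFrom (nextHeight h (k 0)) (Fin.tail k))

theorem starHeightFrom_eq (h : ℕ) {r : ℕ} (k : Fin r → ℕ) (j : Fin r) :
    starHeightFrom h k j = min (k j) (max h
      (Finset.univ.sup fun i : Fin j.val => starHeightFrom h k ⟨i.val, i.2.trans j.2⟩ + 1)) := by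
  induction r generalizing h with
  | zero => exact j.elim0
  | succ r ih =>
    cases j using Fin.cases with
    | zero => simp [starHeightFrom]
    | succ j =>
      have sup_succ (f : Fin (j.val + 1) → ℕ) :
          Finset.univ.sup f = max (f 0) (Finset.univ.sup fun i : Fin j.val => f i.succ) := by
        rw [Fin.univ_succ, Finset.sup_cons, Finset.sup_map]
        rfl
      rw [show starHeightFrom h k j.succ
          = starHeightFrom (nextHeight h (k 0)) (Fin.tail k) j from rfl, ih, nextHeight, max_assoc]
      exact congrArg (fun m => min _ (max h m)) (sup_succ fun i =>
        starHeightFrom h k ⟨i.val, i.2.trans j.succ.2⟩ + 1).symm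

theorem starHeightFrom_zero {r : ℕ} (k : Fin r → ℕ) : starHeightFrom 0 k = starHeight k := by
  funext j
  induction j using WellFoundedLT.induction with
  | ind j ih =>
    rw [starHeightFrom_eq, starHeight, Nat.zero_max]
    exact congrArg (min (k j)) (Finset.sup_congr rfl fun i _ => congrArg (· + 1) (ih _ i.2))

theorem starHeightFrom_le (h : ℕ) {r : ℕ} (k : Fin r → ℕ) (j : Fin r) :
    starHeightFrom h k j ≤ k j :=
  (starHeightFrom_eq h k j).trans_le (min_le_left _ _)

end InitialHeight

/-- A first column for initial `∗`-height `h`: a height `k` and `k - min k h` labels. -/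
abbrev FirstColumn (n : ℕ) (F : Type u) (h : ℕ) : Type u :=
  Σ k : Fin n, Fin (k.val - min k.val h) → F

/-- The analogue of `QSetPartition` for `∗`-heights with initial value `h`. -/
structure QSetPartitionFrom (n : ℕ) (F : Type u) (r h : ℕ) where
  k : Fin r → Fin n
  a : (j : Fin r) → Fin ((k j).val - starHeightFrom h (fun i => (k i).val) j) → F

/-- The first column of height `0`, for initial `∗`-height `0`. -/
def FirstColumn.empty (n : ℕ) [NeZero n] (F : Type u) : FirstColumn n F 0 :=
  ⟨0, fun i => i.elim0⟩

namespace QSetPartitionFrom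

variable {n : ℕ} {F : Type u} {r h : ℕ}

instance : Unique (QSetPartitionFrom n F 0 h) where
  default := ⟨Fin.elim0, fun j => j.elim0⟩
  uniq := by
    rintro ⟨k, a⟩
    obtain rfl : k = Fin.elim0 := Subsingleton.elim _ _
    obtain rfl : a = fun j => j.elim0 := Subsingleton.elim _ _
    rfl

/-- The partition with first column `c` and remaining columns `K`. -/
def cons (c : FirstColumn n F h) (K : QSetPartitionFrom n F r (nextHeight h c.1)) :
    QSetPartitionFrom n F (r + 1) h where
  k := Fin.cons c.1 K.k
  a := Fin.cases c.2 K.a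

/-- A partition is determined by its first column and the remaining ones. -/
def consEquiv (n : ℕ) (F : Type u) (r h : ℕ) :
    (Σ c : FirstColumn n F h, QSetPartitionFrom n F r (nextHeight h c.1)) ≃
      QSetPartitionFrom n F (r + 1) h where
  toFun x := cons x.1 x.2
  invFun K := ⟨⟨K.k 0, K.a 0⟩, ⟨Fin.tail K.k, fun j => K.a j.succ⟩⟩
  left_inv _ := rfl
  right_inv := by
    rintro ⟨k, a⟩
    cases k using Fin.consCases with
    | cons k₀ k =>
      refine congrArg (QSetPartitionFrom.mk (Fin.cons k₀ k)) (funext fun j => ?_)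
      cases j using Fin.cases <;> rfl

/-- For initial `∗`-height `0` one recovers the `q`-set partitions. -/
def equivZero (n r : ℕ) (F : Type u) : QSetPartitionFrom n F r 0 ≃ QSetPartition n r F where
  toFun K := ⟨K.k, fun j i => K.a j (i.cast (by rw [starHeightFrom_zero]))⟩
  invFun K := ⟨K.k, fun j i => K.a j (i.cast (by rw [starHeightFrom_zero]))⟩
  left_inv _ := rfl
  right_inv _ := rfl

/-- A `q`-set partition with empty first column amounts to a partition with initial `∗`-height
`1`. -/
def equivOne (n r : ℕ) [NeZero n] (F : Type u) :
    QSetPartitionFrom n F r 1 ≃ {K : QSetPartition n (r + 1) F // K.k 0 = 0} :=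
  Equiv.ofBijective (fun K => ⟨equivZero n (r + 1) F (cons (.empty n F) K), rfl⟩) <| by
    constructor
    · intro K K' hK
      have hcons := (equivZero n (r + 1) F).injective (Subtype.ext_iff.mp hK)
      exact eq_of_heq (Sigma.mk.inj ((consEquiv n F r 0).injective
        (a₁ := ⟨.empty n F, K⟩) (a₂ := ⟨.empty n F, K'⟩) hcons)).2
    · rintro ⟨K, hK⟩
      obtain ⟨K, rfl⟩ := (equivZero n (r + 1) F).surjective K
      obtain ⟨⟨⟨k, a⟩, K⟩, rfl⟩ := (consEquiv n F r 0).surjective K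
      obtain rfl : k = 0 := hK
      obtain rfl : a = fun i => i.elim0 := funext fun i => i.elim0
      exact ⟨K, rfl⟩

section Columns

variable [Field F] [Fintype F]

/-- The element of `ℂG` attached to the column `j` of `K`. -/
def column (K : QSetPartitionFrom n F r h) (j : Fin r) : MonoidAlgebra ℂ (GL (Fin n) F) :=
  starW (K.k j) (starHeightFrom h (fun i => (K.k i).val) j) (starHeightFrom_le h _ j) (K.a j)

theorem column_equivZero (K : QSetPartitionFrom n F r 0) :
    (equivZero n r F K).column = K.column := by
  funext j
  have starW_congr {k : Fin n} {h h' : ℕ} (hh : h' = h) (hk : h ≤ k.val) (hk' : h' ≤ k.val)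
      (a : Fin (k.val - h) → F) :
      starW k h' hk' (fun i => a (i.cast (by rw [hh]))) = starW k h hk a := by
    subst hh
    rfl
  exact starW_congr (congrFun (starHeightFrom_zero _) j).symm _ _ (K.a j)

theorem tail_column_equivOne [NeZero n] (K : QSetPartitionFrom n F r 1) :
    Fin.tail (equivOne n r F K).val.column = K.column :=
  congrArg Fin.tail (column_equivZero (cons (.empty n F) K))

theorem column_zero_equivOne [NeZero n] (K : QSetPartitionFrom n F r 1) :
    (equivOne n r F K).val.column 0 = 1 := by
  refine (congrFun (column_equivZero (cons (.empty n F) K)) 0).trans ?_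
  change starW (0 : Fin n) 0 le_rfl (fun i => i.elim0) = 1
  simp [starW, sProd, MonoidAlgebra.one_def]

end Columns

end QSetPartitionFrom

/-! ### Counting -/

section Counting

theorem sum_stirlingSecond_mul_prod {R : Type*} [CommSemiring R] {n : ℕ} {a : ℕ → R}
    (han : a n = 0) {N : ℕ → ℕ → R}
    (hN : ∀ r, ∀ l ≤ n, N (r + 1) l = l * N r l + a l * N r (l + 1)) (r s : ℕ) :
    N (r + s) 0 = ∑ l ∈ Finset.range (n + 1),
      Nat.stirlingSecond r l * ((∏ i ∈ Finset.range l, a i) * N s l) := by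
  induction r generalizing s with
  | zero =>
    rw [Finset.sum_range_succ']
    simp
  | succ r ih =>
    let T (l : ℕ) : R := (∏ i ∈ Finset.range l, a i) * N s l
    have hT : T (n + 1) = 0 := by simp [T, Finset.prod_range_succ, han]
    calc N (r + 1 + s) 0
        = ∑ l ∈ Finset.range (n + 1),
            Nat.stirlingSecond r l * ((∏ i ∈ Finset.range l, a i) * N (s + 1) l) := by
          rw [← ih, Nat.add_right_comm, Nat.add_assoc]
      _ = ∑ l ∈ Finset.range (n + 1), (l * Nat.stirlingSecond r l * T l
            + Nat.stirlingSecond r l * T (l + 1)) := by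
          refine Finset.sum_congr rfl fun l hl => ?_
          rw [hN s l (Nat.lt_succ_iff.mp (Finset.mem_range.mp hl))]
          simp only [T, Finset.prod_range_succ]
          ring
      _ = ∑ l ∈ Finset.range n, ((l + 1 : ℕ) * Nat.stirlingSecond r (l + 1) * T (l + 1)
            + Nat.stirlingSecond r l * T (l + 1)) := by
          rw [Finset.sum_add_distrib, Finset.sum_range_succ', Finset.sum_range_succ
            (fun l => (Nat.stirlingSecond r l : R) * T (l + 1)), hT, Finset.sum_add_distrib]
          simp
      _ = ∑ l ∈ Finset.range (n + 1), Nat.stirlingSecond (r + 1) l * T l := by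
          rw [Finset.sum_range_succ', Nat.stirlingSecond_succ_zero, Nat.cast_zero, zero_mul,
            add_zero]
          refine Finset.sum_congr rfl fun l _ => ?_
          rw [Nat.stirlingSecond_succ_succ]
          push_cast
          ring

theorem qInt_pos (q : ℕ) {n : ℕ} (hn : n ≠ 0) : 0 < qInt q n := by
  obtain ⟨m, rfl⟩ := Nat.exists_eq_succ_of_ne_zero hn
  rw [qInt, Finset.sum_range_succ']
  simp

namespace QSetPartitionFrom

instance {n : ℕ} {F : Type u} [Finite F] {r h : ℕ} : Finite (QSetPartitionFrom n F r h) := by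
  induction r generalizing h with
  | zero => infer_instance
  | succ r _ => exact .of_equiv _ (consEquiv n F r h)

variable (n : ℕ) (F : Type u) [Fintype F]

theorem card_succ (r : ℕ) {h : ℕ} (hn : h ≤ n) :
    Nat.card (QSetPartitionFrom n F (r + 1) h) =
      h * Nat.card (QSetPartitionFrom n F r h) +
        qInt (Fintype.card F) (n - h) * Nat.card (QSetPartitionFrom n F r (h + 1)) := by
  let N (h : ℕ) : ℕ := Nat.card (QSetPartitionFrom n F r h)
  have card_eq_sum : Nat.card (QSetPartitionFrom n F (r + 1) h) =
      ∑ k ∈ Finset.range n, Fintype.card F ^ (k - min k h) * N (nextHeight h k) := by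
    rw [← Nat.card_congr (consEquiv n F r h), Nat.card_sigma, ← Finset.univ_sigma_univ,
      Finset.sum_sigma, Finset.sum_range]
    simp [N]
  rw [card_eq_sum, ← Finset.sum_range_add_sum_Ico _ hn, Finset.sum_Ico_eq_sum_range, qInt,
    Finset.sum_mul]
  congr 1
  · have hterm : ∀ k ∈ Finset.range h,
        Fintype.card F ^ (k - min k h) * N (nextHeight h k) = N h := fun k hk => by
      have hk := Finset.mem_range.mp hk
      rw [show k - min k h = 0 by omega, show nextHeight h k = h by unfold nextHeight; omega,
        pow_zero, one_mul]
    rw [Finset.sum_congr rfl hterm, Finset.sum_const, Finset.card_range, smul_eq_mul]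
  · refine Finset.sum_congr rfl fun k _ => ?_
    rw [show h + k - min (h + k) h = k by omega,
      show nextHeight h (h + k) = h + 1 by unfold nextHeight; omega]

theorem card_zero (r : ℕ) : Nat.card (QSetPartitionFrom n F r 0) = d n r (Fintype.card F) := by
  have := sum_stirlingSecond_mul_prod (a := fun i => qInt (Fintype.card F) (n - i))
    (N := fun r h => Nat.card (QSetPartitionFrom n F r h)) (by simp [qInt])
    (fun r _ => card_succ n F r) r 0
  simpa [d] using this

theorem qInt_mul_card_one (r : ℕ) :
    qInt (Fintype.card F) n * Nat.card (QSetPartitionFrom n F r 1) =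
      d n (r + 1) (Fintype.card F) := by
  rw [← card_zero, card_succ n F r (Nat.zero_le n)]
  simp

end QSetPartitionFrom

end Counting

/-! ### Fixed vectors and averages -/

section FixedVectors

variable {k G V W : Type*} [CommRing k] [Group G] [AddCommGroup V] [Module k V]
  [AddCommGroup W] [Module k W]

/-- The space `V^H` of the vectors fixed by a subgroup `H`. -/
def fixedVectors (ρ : Representation k G V) (H : Subgroup G) : Submodule k V :=
  Representation.invariants (ρ.comp H.subtype)

theorem mem_fixedVectors {ρ : Representation k G V} {H : Subgroup G} {v : V} :
    v ∈ fixedVectors ρ H ↔ ∀ u ∈ H, ρ u v = v :=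
  Subtype.forall

theorem fixedVectors_bot (ρ : Representation k G V) : fixedVectors ρ ⊥ = ⊤ :=
  eq_top_iff.mpr fun v _ => mem_fixedVectors.mpr fun u hu => by
    rw [Subgroup.mem_bot.mp hu, map_one, Module.End.one_apply]

variable (ρ : Representation k G V) (H : Subgroup G) [Fintype H] [Invertible (Fintype.card H : k)]

/-- The projection of `V` onto `V^H` by which the idempotent `|H|⁻¹ ∑_{u ∈ H} u` acts. -/
def average : V →ₗ[k] V := Representation.averageMap (ρ.comp H.subtype)

theorem average_apply (v : V) :
    average ρ H v = ⅟(Fintype.card H : k) • ∑ u : H, ρ u.val v := by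
  simp [average, GroupAlgebra.average]

theorem average_mem_fixedVectors (v : V) : average ρ H v ∈ fixedVectors ρ H :=
  Representation.averageMap_invariant (ρ.comp H.subtype) v

variable {H} in
theorem average_of_mem_fixedVectors {v : V} (hv : v ∈ fixedVectors ρ H) : average ρ H v = v :=
  Representation.averageMap_id (ρ.comp H.subtype) v hv

theorem range_average : LinearMap.range (average ρ H) = fixedVectors ρ H :=
  le_antisymm (LinearMap.range_le_iff_comap.mpr (eq_top_iff.mpr fun v _ =>
    average_mem_fixedVectors ρ H v)) fun v hv => ⟨v, average_of_mem_fixedVectors ρ hv⟩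

variable {ρ H} in
theorem apply_average_of_forall (f : V →ₗ[k] W) {v : V} (hf : ∀ u ∈ H, f (ρ u v) = f v) :
    f (average ρ H v) = f v := by
  rw [average_apply, map_smul, map_sum, Finset.sum_congr rfl fun u _ => hf u.val u.2,
    Finset.sum_const, Finset.card_univ, ← Nat.cast_smul_eq_nsmul k, invOf_smul_smul]

variable {H} in
theorem average_smul {u : G} (hu : u ∈ H) (v : V) : average ρ H (ρ u v) = average ρ H v := by
  rw [average_apply, average_apply]
  congr 1
  refine Fintype.sum_equiv (Equiv.mulRight (⟨u, hu⟩ : H)) _ _ fun w => ?_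
  simp

variable {H} in
theorem average_congr {H' : Subgroup G} [Fintype H'] [Invertible (Fintype.card H' : k)]
    (h : H = H') : average ρ H = average ρ H' := by
  ext v
  calc average ρ H v = average ρ H' (average ρ H v) :=
        (average_of_mem_fixedVectors ρ (h ▸ average_mem_fixedVectors ρ H v)).symm
    _ = average ρ H' v := apply_average_of_forall _ fun u hu => average_smul ρ (h ▸ hu) v

end FixedVectors

/-! ### The Mackey decomposition of the fixed vectors of an induced module -/

theorem dfinsupp_basis_apply {k ι : Type*} [CommRing k] {κ M : ι → Type*}
    [∀ i, AddCommGroup (M i)] [∀ i, Module k (M i)] [DecidableEq ι]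
    (b : ∀ i, Module.Basis (κ i) k (M i)) (i : ι) (j : κ i) :
    DFinsupp.basis b ⟨i, j⟩ = DFinsupp.single i (b i j) := by
  classical
  refine (DFinsupp.basis b).repr.injective ?_
  rw [Module.Basis.repr_self]
  simp [DFinsupp.basis, Equiv.eq_symm_apply, sigmaFinsuppEquivDFinsupp_single]

section Mackey

variable {k G V : Type*} [CommRing k] [Group G] {P : Subgroup G} [AddCommGroup V] [Module k V]
  (ρ : Representation k P V)

/-- The tensor `g ⊗ v` in the module `kG ⊗_{kP} V` induced from `V`; see `groupTmul` for the
inverse. -/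
def indTmul (g : G) : V →ₗ[k] Representation.IndV P.subtype ρ :=
  Representation.IndV.mk P.subtype ρ g⁻¹

theorem ind_indTmul (h g : G) (v : V) :
    Representation.ind P.subtype ρ h (indTmul ρ g v) = indTmul ρ (h * g) v := by
  rw [indTmul, indTmul, Representation.ind_mk, mul_inv_rev]

theorem indTmul_mul (g : G) (p : P) (v : V) : indTmul ρ (g * p) v = indTmul ρ g (ρ p v) := by
  have := Representation.Coinvariants.mk_inv_tmul
    ((Representation.leftRegular k G).comp P.subtype) ρ (MonoidAlgebra.single g⁻¹ 1) v p
  simpa [indTmul, Representation.leftRegular, Representation.ofMulAction_single] using this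

variable {ρ} in
theorem eq_top_of_indTmul_mem {S : Submodule k (Representation.IndV P.subtype ρ)}
    (hS : ∀ g v, indTmul ρ g v ∈ S) : S = ⊤ := by
  have : S.mkQ = 0 := Representation.IndV.hom_ext _ _ fun g => by
    ext v
    have := hS g⁻¹ v
    rw [indTmul, inv_inv] at this
    exact (Submodule.Quotient.mk_eq_zero S).mpr this
  rw [← S.ker_mkQ, this, LinearMap.ker_zero]

open scoped Classical in
/-- The coefficient at `g` of an element of the induced module `⨁_{gP} g ⊗ V`. -/
def indCoeff (g : G) : Representation.IndV P.subtype ρ →ₗ[k] V :=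
  LinearMap.proj g⁻¹ ∘ₗ Submodule.subtype _ ∘ₗ (Rep.of ρ).indToCoind

open scoped Classical in
theorem indCoeff_indTmul (g x : G) (v : V) :
    indCoeff ρ g (indTmul ρ x v) = Rep.indToCoindAux (Rep.of ρ) x⁻¹ v g⁻¹ := by
  simp only [indCoeff, indTmul, LinearMap.coe_comp, Function.comp_apply, TensorProduct.mk_apply,
    LinearMap.coe_proj, Submodule.coe_subtype, Function.eval, Representation.Coinvariants.lift_mk,
    TensorProduct.lift.tmul, LinearEquiv.coe_coe, MonoidAlgebra.coeffLinearEquiv_apply,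
    MonoidAlgebra.coeff_single, Finsupp.linearCombination_single, one_smul]
  rfl

theorem indCoeff_indTmul_self (g : G) (v : V) : indCoeff ρ g (indTmul ρ g v) = v := by
  classical
  rw [indCoeff_indTmul, Rep.indToCoindAux_self]

theorem indCoeff_indTmul_of_notMem {g x : G} (hx : g⁻¹ * x ∉ P) (v : V) :
    indCoeff ρ g (indTmul ρ x v) = 0 := by
  classical
  rw [indCoeff_indTmul, Rep.indToCoindAux_of_not_rel]
  rwa [QuotientGroup.rightRel_apply, ← P.inv_mem_iff, mul_inv_rev, inv_inv, inv_inv]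

/-- The subgroup `P ∩ g⁻¹ H g` of `P`. -/
def infConj (P H : Subgroup G) (g : G) : Subgroup P :=
  H.comap ((MulAut.conj g).toMonoidHom.comp P.subtype)

theorem mem_infConj {H : Subgroup G} {g : G} {p : P} : p ∈ infConj P H g ↔ g * p * g⁻¹ ∈ H :=
  Iff.rfl

theorem card_infConj_dvd (P H : Subgroup G) (g : G) : Nat.card (infConj P H g) ∣ Nat.card H :=
  Subgroup.card_comap_dvd_of_injective _ _
    ((MulAut.conj g).injective.comp P.subtype_injective)

variable (H : Subgroup G) [Fintype H] [Invertible (Fintype.card H : k)]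

theorem average_indTmul_mul {h : G} (hh : h ∈ H) (g : G) (v : V) :
    average (Representation.ind P.subtype ρ) H (indTmul ρ (h * g) v) =
      average (Representation.ind P.subtype ρ) H (indTmul ρ g v) := by
  rw [← ind_indTmul, average_smul _ hh]

theorem isUnit_natCast_of_dvd_card {m : ℕ} (hm : m ∣ Nat.card H) : IsUnit (m : k) :=
  isUnit_of_dvd_unit (Nat.cast_dvd_cast hm)
    (Nat.card_eq_fintype_card (α := H) ▸ isUnit_of_invertible _)

theorem exists_isUnit_indCoeff_average (g : G) : ∃ c : k, IsUnit c ∧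
    ∀ v ∈ fixedVectors ρ (infConj P H g),
      indCoeff ρ g (average (Representation.ind P.subtype ρ) H (indTmul ρ g v)) = c • v := by
  classical
  refine ⟨⅟(Fintype.card H : k) * Nat.card (infConj H P g⁻¹), (isUnit_of_invertible _).mul
    (isUnit_natCast_of_dvd_card H (Subgroup.card_subgroup_dvd_card _)), fun v hv => ?_⟩
  have coeff (u : H) : indCoeff ρ g (indTmul ρ (u * g) v) =
      if u ∈ infConj H P g⁻¹ then v else 0 := by
    split_ifs with hu
    · rw [mem_infConj, inv_inv] at hu
      have hfix := mem_fixedVectors.mp hv ⟨g⁻¹ * u * g, hu⟩ (by simp [mem_infConj, mul_assoc])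
      rw [show u.val * g = g * (⟨g⁻¹ * u * g, hu⟩ : P) by simp [mul_assoc], indTmul_mul, hfix,
        indCoeff_indTmul_self]
    · exact indCoeff_indTmul_of_notMem ρ (by simpa [mem_infConj, mul_assoc] using hu) v
  rw [average_apply, map_smul, map_sum, mul_smul]
  congr 1
  simp_rw [ind_indTmul, coeff]
  rw [← Finset.sum_filter, Finset.sum_const, Nat.cast_smul_eq_nsmul, Nat.card_eq_fintype_card,
    Fintype.card_subtype]

theorem indCoeff_average_of_ne {g x : G} (hgx : DoubleCoset.mk H P x ≠ DoubleCoset.mk H P g)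
    (v : V) :
    indCoeff ρ g (average (Representation.ind P.subtype ρ) H (indTmul ρ x v)) = 0 := by
  rw [average_apply, map_smul, map_sum, Finset.sum_eq_zero, smul_zero]
  intro u _
  rw [ind_indTmul]
  refine indCoeff_indTmul_of_notMem ρ (fun hp => hgx ?_) v
  exact (DoubleCoset.eq H P x g).mpr
    ⟨u, u.2, (g⁻¹ * (u * x))⁻¹, P.inv_mem hp, by simp [mul_assoc]⟩

variable {ι : Type*} (g : ι → G)

open scoped Classical in
/-- The sum over `i` of the maps `v ↦ |H|⁻¹ ∑_{h ∈ H} h g_i ⊗ v` from `V^{P ∩ g_i⁻¹ H g_i}` to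
the fixed vectors of `H` in the induced module. -/
def mackeyMap : (Π₀ i, fixedVectors ρ (infConj P H (g i))) →ₗ[k]
    fixedVectors (Representation.ind P.subtype ρ) H :=
  DFinsupp.lsum ℕ fun i => ((average (Representation.ind P.subtype ρ) H).codRestrict _
    (average_mem_fixedVectors _ H)) ∘ₗ indTmul ρ (g i) ∘ₗ Submodule.subtype _

open scoped Classical in
theorem mackeyMap_single (i : ι) (v : fixedVectors ρ (infConj P H (g i))) :
    (mackeyMap ρ H g (DFinsupp.single i v) : Representation.IndV P.subtype ρ) =
      average (Representation.ind P.subtype ρ) H (indTmul ρ (g i) v) := by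
  simp [mackeyMap]

variable {g}

theorem mackeyMap_injective (hg : Function.Injective fun i => DoubleCoset.mk H P (g i)) :
    Function.Injective (mackeyMap ρ H g) := by
  classical
  refine (injective_iff_map_eq_zero _).mpr fun f hf => DFinsupp.ext fun i => Subtype.ext ?_
  obtain ⟨c, hc, hself⟩ := exists_isUnit_indCoeff_average ρ H (g i)
  have coeff (f : Π₀ i, fixedVectors ρ (infConj P H (g i))) :
      indCoeff ρ (g i) (mackeyMap ρ H g f) = c • (f i : V) := by
    induction f using DFinsupp.induction with
    | h0 => simp
    | ha j v f _ _ ih =>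
      rw [map_add, Submodule.coe_add, map_add, ih, mackeyMap_single, DFinsupp.add_apply,
        Submodule.coe_add, smul_add]
      congr 1
      obtain rfl | hij := eq_or_ne j i
      · rw [hself v v.2, DFinsupp.single_eq_same]
      · rw [indCoeff_average_of_ne ρ H (hg.ne hij), DFinsupp.single_eq_of_ne hij.symm,
          Submodule.coe_zero, smul_zero]
  have := coeff f
  rw [hf, Submodule.coe_zero, map_zero, eq_comm, hc.smul_eq_zero] at this
  exact this

theorem average_indTmul_mem_range_mackeyMap (i : ι) (v : V) :
    (⟨average (Representation.ind P.subtype ρ) H (indTmul ρ (g i) v),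
      average_mem_fixedVectors _ H _⟩ : fixedVectors (Representation.ind P.subtype ρ) H) ∈
      LinearMap.range (mackeyMap ρ H g) := by
  classical
  have hcard := card_infConj_dvd P H (g i)
  have : Finite (infConj P H (g i)) := (Nat.card_pos_iff.mp (Nat.pos_of_dvd_of_pos hcard
    Nat.card_pos)).2
  have := Fintype.ofFinite (infConj P H (g i))
  have : Invertible (Fintype.card (infConj P H (g i)) : k) :=
    (Nat.card_eq_fintype_card (α := infConj P H (g i)) ▸
      isUnit_natCast_of_dvd_card (k := k) H hcard).invertible
  refine ⟨DFinsupp.single i ⟨average ρ (infConj P H (g i)) v, average_mem_fixedVectors ρ _ v⟩,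
    Subtype.ext ?_⟩
  rw [mackeyMap_single]
  refine apply_average_of_forall (average _ H ∘ₗ indTmul ρ (g i)) fun p hp => ?_
  rw [LinearMap.comp_apply, LinearMap.comp_apply, ← indTmul_mul,
    ← inv_mul_cancel_right (g i * p) (g i)]
  exact average_indTmul_mul ρ H hp _ _

theorem mackeyMap_surjective (hg : Function.Surjective fun i => DoubleCoset.mk H P (g i)) :
    Function.Surjective (mackeyMap ρ H g) := fun x => by
  have htop : (LinearMap.range (mackeyMap ρ H g)).comap
      ((average (Representation.ind P.subtype ρ) H).codRestrict _
        (average_mem_fixedVectors _ H)) = ⊤ := eq_top_of_indTmul_mem fun y v => by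
    obtain ⟨i, hi⟩ := hg (DoubleCoset.mk H P y)
    obtain ⟨h, hh, p, hp, rfl⟩ := (DoubleCoset.eq H P (g i) y).mp hi
    have hrep := average_indTmul_mem_range_mackeyMap ρ H (g := g) i (ρ ⟨p, hp⟩ v)
    simp only [← indTmul_mul, ← average_indTmul_mul ρ H hh (g i * _), ← mul_assoc] at hrep
    exact hrep
  have hx : (x : Representation.IndV P.subtype ρ) ∈ Submodule.comap _ _ := htop.ge trivial
  rwa [Submodule.mem_comap, show LinearMap.codRestrict _ _ _ x.val = x from
    Subtype.ext (average_of_mem_fixedVectors _ x.2)] at hx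

/-- The basis of the fixed vectors of `H` in the module induced from `P` that is obtained from
bases of `V^{P ∩ g_i⁻¹ H g_i}`, where the `g_i` represent the double cosets `H \ G / P`. -/
def mackeyBasis (hg : Function.Bijective fun i => DoubleCoset.mk H P (g i)) {κ : ι → Type*}
    (b : ∀ i, Module.Basis (κ i) k (fixedVectors ρ (infConj P H (g i)))) :
    Module.Basis (Σ i, κ i) k (fixedVectors (Representation.ind P.subtype ρ) H) :=
  (DFinsupp.basis b).map (LinearEquiv.ofBijective (mackeyMap ρ H g)
    ⟨mackeyMap_injective ρ H hg.1, mackeyMap_surjective ρ H hg.2⟩)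

theorem mackeyBasis_apply (hg : Function.Bijective fun i => DoubleCoset.mk H P (g i))
    {κ : ι → Type*} (b : ∀ i, Module.Basis (κ i) k (fixedVectors ρ (infConj P H (g i))))
    (i : ι) (j : κ i) :
    (mackeyBasis ρ H hg b ⟨i, j⟩ : Representation.IndV P.subtype ρ) =
      average (Representation.ind P.subtype ρ) H (indTmul ρ (g i) (b i j)) := by
  classical
  rw [← mackeyMap_single, mackeyBasis, Module.Basis.map_apply, dfinsupp_basis_apply]
  rfl

end Mackey

/-! ### Fixed vectors in Harish-Chandra restricted and induced modules -/

section HarishChandraFixed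

theorem fixedVectors_sup {k G V : Type*} [CommRing k] [Group G] [AddCommGroup V] [Module k V]
    (ρ : Representation k G V) (H K : Subgroup G) :
    fixedVectors ρ (H ⊔ K) = fixedVectors ρ H ⊓ fixedVectors ρ K := by
  ext v
  let _ : MulAction G V := MulAction.compHom V ρ
  have hstab (H : Subgroup G) : v ∈ fixedVectors ρ H ↔ H ≤ MulAction.stabilizer G v :=
    mem_fixedVectors
  rw [Submodule.mem_inf, hstab, hstab, hstab, sup_le_iff]

instance {G : Type*} [Group G] (H : Subgroup G) [Fintype H] : Invertible (Fintype.card H : ℂ) :=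
  invertibleOfNonzero (Nat.cast_ne_zero.mpr Fintype.card_ne_zero)

variable {n : ℕ} [NeZero n] {F : Type u} [Field F]

theorem levi_le_parabolic : levi n F ≤ parabolic n F := fun _ hl i hi =>
  hl i 0 (by simp [hi])

theorem toLevi_apply (p : parabolic n F) (i j : Fin n) :
    (toLevi n F p).val.val i j = if (i = 0 ↔ j = 0) then p.val.val i j else 0 := rfl

theorem mem_unip_of_toLevi_eq_one {p : parabolic n F} (hp : toLevi n F p = 1) :
    p.val ∈ unip n F := by
  intro i j hij
  have hentry := toLevi_apply p i j
  rw [hp] at hentry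
  by_cases hdiag : i = 0 ↔ j = 0
  · rw [if_pos hdiag] at hentry
    exact hentry.symm
  · have hi : i ≠ 0 := hij.elim id fun hj hi => hdiag (iff_of_true hi hj)
    obtain rfl : j = 0 := by_contra fun hj => hdiag (iff_of_false hi hj)
    rw [p.2 i hi, Matrix.one_apply_ne hi]

theorem toLevi_inclusion (l : levi n F) :
    toLevi n F (Subgroup.inclusion levi_le_parabolic l) = l := by
  refine Subtype.ext (Units.ext (Matrix.ext fun i j => ?_))
  rw [toLevi_apply]
  split_ifs with hij
  · rfl
  · exact (l.2 i j hij).symm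

theorem toLevi_inv_mul_mem_unip (p : parabolic n F) :
    (toLevi n F p).val⁻¹ * p.val ∈ unip n F :=
  mem_unip_of_toLevi_eq_one (p := (Subgroup.inclusion levi_le_parabolic (toLevi n F p))⁻¹ * p)
    (by rw [map_mul, map_inv, toLevi_inclusion, inv_mul_cancel])

theorem groupTmul_one_injective (V : Rep.{u} ℂ (levi n F)) :
    Function.Injective (groupTmul V 1) :=
  Function.LeftInverse.injective (g := indCoeff (Infl V).ρ 1)
    (indCoeff_indTmul_self (Infl V).ρ 1)

variable [Fintype F]

theorem eUOp_eq_average (V : Rep.{u} ℂ (GL (Fin n) F)) :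
    eUOp V = average V.ρ (unip n F) := by
  ext v
  simp [eUOp, eU, average_apply]

/-- The action of `P` on `e_U V` by inflation, that is, the action underlying `Infl (Resf V)`. -/
def inflResf (V : Rep.{u} ℂ (GL (Fin n) F)) : Representation ℂ (parabolic n F) (Resf V) :=
  (Resf V).ρ.comp (toLevi n F)

/-- The inclusion of `e_U V` into `V`. -/
def resfSubtype (V : Rep.{u} ℂ (GL (Fin n) F)) : Resf V →ₗ[ℂ] V :=
  (LinearMap.range (eUOp V)).subtype

theorem resfSubtype_injective (V : Rep.{u} ℂ (GL (Fin n) F)) :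
    Function.Injective (resfSubtype V) :=
  Subtype.val_injective

theorem resfSubtype_toResf (V : Rep.{u} ℂ (GL (Fin n) F)) (v : V) :
    resfSubtype V (toResf V v) = average V.ρ (unip n F) v :=
  LinearMap.congr_fun (eUOp_eq_average V) v

theorem range_resfSubtype (V : Rep.{u} ℂ (GL (Fin n) F)) :
    LinearMap.range (resfSubtype V) = fixedVectors V.ρ (unip n F) := by
  rw [← range_average, ← eUOp_eq_average]
  exact Submodule.range_subtype _

theorem resfSubtype_inflResf (V : Rep.{u} ℂ (GL (Fin n) F)) (p : parabolic n F) (y : Resf V) :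
    resfSubtype V (inflResf V p y) = V.ρ p.val (resfSubtype V y) := by
  have hy : resfSubtype V y ∈ fixedVectors V.ρ (unip n F) := range_resfSubtype V ▸ ⟨y, rfl⟩
  rw [← mul_inv_cancel_left (toLevi n F p).val p.val, map_mul, Module.End.mul_apply,
    mem_fixedVectors.mp hy _ (toLevi_inv_mul_mem_unip p)]
  rfl

theorem map_resfSubtype_fixedVectors (V : Rep.{u} ℂ (GL (Fin n) F))
    (S : Subgroup (parabolic n F)) :
    (fixedVectors (inflResf V) S).map (resfSubtype V) =
      fixedVectors V.ρ (S.map (parabolic n F).subtype ⊔ unip n F) := by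
  have hfixed (y : Resf V) : y ∈ fixedVectors (inflResf V) S ↔
      resfSubtype V y ∈ fixedVectors V.ρ (S.map (parabolic n F).subtype) := by
    simp only [mem_fixedVectors, Subgroup.mem_map, forall_exists_index, and_imp,
      forall_apply_eq_imp_iff₂, Subgroup.subtype_apply, ← resfSubtype_inflResf,
      (resfSubtype_injective V).eq_iff]
  rw [fixedVectors_sup, ← range_resfSubtype, inf_comm, ← Submodule.map_comap_eq]
  exact congrArg _ (Submodule.ext hfixed)

/-- The identification of the vectors of `e_U V` fixed by `S ≤ P` with the vectors of `V` fixed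
by `S U`. -/
def resfFixedEquiv (V : Rep.{u} ℂ (GL (Fin n) F)) (S : Subgroup (parabolic n F)) :
    fixedVectors (inflResf V) S ≃ₗ[ℂ]
      fixedVectors V.ρ (S.map (parabolic n F).subtype ⊔ unip n F) :=
  (Submodule.equivMapOfInjective (resfSubtype V) (resfSubtype_injective V) _).trans
    (LinearEquiv.ofEq _ _ (map_resfSubtype_fixedVectors V S))

theorem resfSubtype_resfFixedEquiv_symm (V : Rep.{u} ℂ (GL (Fin n) F))
    (S : Subgroup (parabolic n F))
    (v : fixedVectors V.ρ (S.map (parabolic n F).subtype ⊔ unip n F)) :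
    resfSubtype V ((resfFixedEquiv V S).symm v) = v :=
  congrArg Subtype.val ((resfFixedEquiv V S).apply_symm_apply v)

end HarishChandraFixed

/-! ### The unipotent radicals `U_h` of the parabolic subgroups of type `(1, …, 1, n - h)` -/

section UnipRows

variable {n : ℕ} {F : Type u} [Field F]

/-- Strictly upper triangular matrices whose nonzero entries lie in the first `h` rows. They form
an ideal of the ring of upper triangular matrices. -/
def IsStrictUpperRows (h : ℕ) (N : Matrix (Fin n) (Fin n) F) : Prop :=
  ∀ i j : Fin n, ¬ (i < j ∧ i.val < h) → N i j = 0

theorem IsStrictUpperRows.mul_left {h : ℕ} {T N : Matrix (Fin n) (Fin n) F}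
    (hN : IsStrictUpperRows h N) (hT : T.BlockTriangular id) : IsStrictUpperRows h (T * N) := by
  intro i j hij
  rw [Matrix.mul_apply]
  refine Finset.sum_eq_zero fun m _ => ?_
  obtain hm | hm := lt_or_ge m i
  · rw [hT hm, zero_mul]
  · rw [hN m j fun hmj => hij ⟨hm.trans_lt hmj.1, (Fin.le_def.mp hm).trans_lt hmj.2⟩, mul_zero]

theorem IsStrictUpperRows.mul_right {h : ℕ} {T N : Matrix (Fin n) (Fin n) F}
    (hN : IsStrictUpperRows h N) (hT : T.BlockTriangular id) : IsStrictUpperRows h (N * T) := by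
  intro i j hij
  rw [Matrix.mul_apply]
  refine Finset.sum_eq_zero fun m _ => ?_
  obtain hm | hm := lt_or_ge j m
  · rw [hT hm, mul_zero]
  · rw [hN i m fun him => hij ⟨him.1.trans_le hm, him.2⟩, zero_mul]

theorem IsStrictUpperRows.blockTriangular {h : ℕ} {M : Matrix (Fin n) (Fin n) F}
    (hM : IsStrictUpperRows h (M - 1)) : M.BlockTriangular id := by
  rw [← sub_add_cancel M 1]
  exact .add (fun i j hij => hM i j fun hlt => hij.asymm hlt.1) Matrix.blockTriangular_one

theorem blockTriangular_inv {g : GL (Fin n) F} (hg : g.val.BlockTriangular id) :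
    g⁻¹.val.BlockTriangular id := by
  let _ : Invertible g.val := g.invertible
  rw [Matrix.coe_units_inv]
  exact Matrix.blockTriangular_inv_of_blockTriangular hg

variable (n F) in
/-- The group `U_h` of the matrices that agree with the identity matrix except possibly in the
entries `(i, j)` with `i < j` and `i < h`. -/
def unipRows (h : ℕ) : Subgroup (GL (Fin n) F) where
  carrier := {g | IsStrictUpperRows h (g.val - 1)}
  one_mem' := fun i j _ => by simp
  mul_mem' := by
    intro a b ha hb i j hij
    have hab : (a * b).val - 1 = a.val * (b.val - 1) + (a.val - 1) := by
      rw [Units.val_mul, mul_sub, mul_one, sub_add_sub_cancel]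
    rw [hab, Matrix.add_apply, hb.mul_left ha.blockTriangular i j hij, ha i j hij, add_zero]
  inv_mem' := by
    intro g hg i j hij
    have hinv : g⁻¹.val - 1 = -(g⁻¹.val * (g.val - 1)) := by
      rw [mul_sub, mul_one, ← Units.val_mul, inv_mul_cancel, Units.val_one, neg_sub]
    rw [hinv, Matrix.neg_apply,
      IsStrictUpperRows.mul_left hg (blockTriangular_inv hg.blockTriangular) i j hij, neg_zero]

theorem mem_unipRows {h : ℕ} {g : GL (Fin n) F} :
    g ∈ unipRows n F h ↔ ∀ i j : Fin n, ¬ (i < j ∧ i.val < h) →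
      g.val i j = (1 : Matrix (Fin n) (Fin n) F) i j :=
  forall₃_congr fun i j _ => by rw [Matrix.sub_apply, sub_eq_zero]

theorem unipRows_zero : unipRows n F 0 = ⊥ :=
  (Subgroup.eq_bot_iff_forall _).mpr fun _ hg => Units.ext <| Matrix.ext fun i j =>
    mem_unipRows.mp hg i j fun hij => Nat.not_lt_zero _ hij.2

theorem unipRows_one [NeZero n] : unipRows n F 1 = unip n F := by
  ext g
  rw [mem_unipRows]
  refine forall₂_congr fun i j => imp_congr_left ?_
  simp only [Fin.lt_def, Ne, Fin.ext_iff, Fin.val_zero]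
  omega

theorem unipRows_mono : Monotone (unipRows n F) := fun _ _ hh _ hg i j hij =>
  hg i j fun hlt => hij ⟨hlt.1, hlt.2.trans_le hh⟩

theorem unipRows_le_parabolic [NeZero n] (h : ℕ) : unipRows n F h ≤ parabolic n F :=
  fun _ hg i hi => by rw [mem_unipRows.mp hg i 0 (by simp), Matrix.one_apply_ne hi]

theorem conj_mem_unipRows {h : ℕ} {t g : GL (Fin n) F} (ht : t.val.BlockTriangular id)
    (hg : g ∈ unipRows n F h) : t * g * t⁻¹ ∈ unipRows n F h := by
  have hconj : (t * g * t⁻¹).val - 1 = t.val * (g.val - 1) * t⁻¹.val := by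
    rw [mul_sub, mul_one, sub_mul, ← Units.val_mul, ← Units.val_mul, ← Units.val_mul,
      mul_inv_cancel, Units.val_one]
  change IsStrictUpperRows h _
  rw [hconj]
  exact (IsStrictUpperRows.mul_left hg ht).mul_right (blockTriangular_inv ht)

theorem conj_mem_unipRows_iff {h : ℕ} {t g : GL (Fin n) F} (ht : t.val.BlockTriangular id) :
    t * g * t⁻¹ ∈ unipRows n F h ↔ g ∈ unipRows n F h := by
  refine ⟨fun hg => ?_, conj_mem_unipRows ht⟩
  simpa [mul_assoc] using conj_mem_unipRows (blockTriangular_inv ht) hg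

instance [Fintype F] (h : ℕ) : Fintype (unipRows n F h) := Fintype.ofFinite _

end UnipRows

/-! ### The products `s_k(c_k) ⋯ s_1(c_1)` -/

section ColumnElements

variable {n : ℕ} {F : Type u} [Field F]

/-- The element `s_k(c_{k-1}) ⋯ s_1(c_0)` for a sequence of labels `c`, of which only the first
`k` matter. -/
def columnElt (k : Fin n) (c : ℕ → F) : GL (Fin n) F :=
  sProd 0 k.val (by omega) fun i => c i

theorem sProd_mul_sProd_zero {l m : ℕ} {k : Fin n} (hk : l + m = k.val) (c : ℕ → F) :
    sProd l m (by omega) (fun i => c (l + i)) * sProd 0 l (by omega) (fun i => c i) =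
      columnElt k c := by
  obtain ⟨k, hkn⟩ := k
  obtain rfl : l + m = k := hk
  induction m with
  | zero => exact one_mul _
  | succ m ih =>
    rw [sProd, mul_assoc]
    refine (congrArg _ (ih (by omega))).trans ?_
    simp only [columnElt, sProd, Nat.zero_add]
    rfl

theorem columnElt_succ {k : ℕ} (hk : k + 1 < n) (c : ℕ → F) :
    columnElt ⟨k + 1, hk⟩ c = sElt k hk (c k) * columnElt ⟨k, by omega⟩ c := by
  rw [← sProd_mul_sProd_zero (l := k) (m := 1) rfl, sProd, sProd, mul_one]
  rfl

theorem sElt_mul_apply {i : ℕ} (hi : i + 1 < n) (a : F) (M : Matrix (Fin n) (Fin n) F)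
    (r j : Fin n) :
    ((sElt i hi a).val * M) r j = M (Equiv.swap ⟨i, by omega⟩ ⟨i + 1, hi⟩ r) j +
      if r.val = i then a * M ⟨i, by omega⟩ j else 0 := by
  have hswap (r : Fin n) : (Matrix.swap F (⟨i, by omega⟩ : Fin n) ⟨i + 1, hi⟩ * M) r j =
      M (Equiv.swap ⟨i, by omega⟩ ⟨i + 1, hi⟩ r) j :=
    congrFun (congrFun (PEquiv.toMatrix_toPEquiv_mul _ M) r) j
  rw [sElt, Units.val_mul, Matrix.mul_assoc]
  change (Matrix.transvection ⟨i, _⟩ ⟨i + 1, _⟩ a *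
    (Matrix.swap F (⟨i, _⟩ : Fin n) ⟨i + 1, _⟩ * M) : Matrix (Fin n) (Fin n) F) r j = _
  split_ifs with hr
  · obtain rfl : r = ⟨i, Nat.lt_of_succ_lt hi⟩ := Fin.ext hr
    rw [Matrix.transvection_mul_apply_same, hswap, hswap, Equiv.swap_apply_right]
  · rw [Matrix.transvection_mul_apply_of_ne (ha := fun h => hr (congrArg Fin.val h)), hswap,
      add_zero]

theorem val_cycleRange (k i : Fin n) : (k.cycleRange i).val =
    if i.val < k.val then i.val + 1 else if i.val = k.val then 0 else i.val := by
  split_ifs with hlt heq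
  · exact Fin.coe_cycleRange_of_lt hlt
  · rw [Fin.ext heq, Fin.coe_cycleRange_of_le le_rfl, if_pos rfl]
  · rw [Fin.cycleRange_of_gt (Fin.lt_def.mpr (by omega))]

theorem cycleRange_swap {k : ℕ} (hk : k + 1 < n) (i : Fin n) :
    Fin.cycleRange ⟨k, by omega⟩ (Equiv.swap ⟨k, by omega⟩ ⟨k + 1, hk⟩ i) =
      Fin.cycleRange ⟨k + 1, hk⟩ i := by
  refine Fin.ext ?_
  rw [val_cycleRange, val_cycleRange, Equiv.swap_apply_def]
  grind

variable [NeZero n]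

theorem columnElt_mul_apply (k : Fin n) (c : ℕ → F) (M : Matrix (Fin n) (Fin n) F) (i j : Fin n) :
    ((columnElt k c).val * M) i j =
      M (k.cycleRange i) j + if i < k then c i * M 0 j else 0 := by
  obtain ⟨k, hk⟩ := k
  induction k generalizing i with
  | zero =>
    rw [Fin.cycleRange_mk_zero, if_neg (by simp), add_zero]
    exact congrFun (congrFun (Matrix.one_mul M) i) j
  | succ k ih =>
    rw [columnElt_succ, Units.val_mul, Matrix.mul_assoc, sElt_mul_apply, ih, ih, cycleRange_swap,
      add_assoc]
    congr 1
    obtain hik | rfl | hik := lt_trichotomy i ⟨k, Nat.lt_of_succ_lt hk⟩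
    · have hik' : i < ⟨k + 1, hk⟩ := hik.trans (Fin.mk_lt_mk.mpr k.lt_succ_self)
      rw [Equiv.swap_apply_of_ne_of_ne hik.ne hik'.ne, if_pos hik, if_pos hik',
        if_neg (Fin.lt_def.mp hik).ne, add_zero]
    · simp [Fin.lt_def, Fin.cycleRange_self]
    · have hik' : ¬ i < ⟨k + 1, hk⟩ := hik.not_ge ∘ Nat.le_of_lt_succ
      have hswap : ¬ Equiv.swap (⟨k, Nat.lt_of_succ_lt hk⟩ : Fin n) ⟨k + 1, hk⟩ i <
          ⟨k, Nat.lt_of_succ_lt hk⟩ := by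
        grind
      rw [if_neg (Fin.lt_def.mp hik).ne', if_neg hik', if_neg hswap, add_zero]

theorem columnElt_zero_labels (k : Fin n) :
    (columnElt k (0 : ℕ → F)).val = k.cycleRange.permMatrix F := by
  rw [← Matrix.mul_one (columnElt k 0).val, Equiv.Perm.permMatrix,
    ← Matrix.mul_one (PEquiv.toMatrix _), PEquiv.toMatrix_toPEquiv_mul]
  ext i j
  rw [columnElt_mul_apply, Matrix.submatrix_apply, Pi.zero_apply, zero_mul, ite_self, add_zero,
    id]

theorem columnElt_zero_labels_conj_apply (k : Fin n) (g : GL (Fin n) F) (i j : Fin n) :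
    (columnElt k 0 * g * (columnElt k 0)⁻¹).val i j =
      g.val (k.cycleRange i) (k.cycleRange j) := by
  suffices h : (columnElt k 0 * g).val =
      g.val.submatrix k.cycleRange k.cycleRange * (columnElt k 0).val by
    rw [Units.val_mul, h, Matrix.mul_assoc, ← Units.val_mul, mul_inv_cancel, Units.val_one,
      Matrix.mul_one, Matrix.submatrix_apply]
  rw [Units.val_mul, columnElt_zero_labels, Equiv.Perm.permMatrix, PEquiv.toMatrix_toPEquiv_mul,
    PEquiv.mul_toMatrix_toPEquiv, Matrix.submatrix_submatrix, Equiv.self_comp_symm]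
  rfl

theorem exists_mem_unipRows_mul_columnElt {h : ℕ} (k : Fin n) {c c' : ℕ → F}
    (hc : ∀ i, h ≤ i → i < k.val → c i = c' i) :
    ∃ u ∈ unipRows n F h, columnElt k c = u * columnElt k c' := by
  let D : Matrix (Fin n) (Fin n) F :=
    Matrix.of fun i j => if j = k ∧ i < k then c i - c' i else 0
  have hD : D * (columnElt k c').val = (columnElt k c).val - (columnElt k c').val := by
    ext i j
    rw [Matrix.sub_apply, ← Matrix.mul_one (columnElt k c).val,
      ← Matrix.mul_one (columnElt k c').val, columnElt_mul_apply, columnElt_mul_apply,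
      Matrix.mul_apply, Finset.sum_eq_single k fun m _ hm => by simp [D, hm]]
    · rw [columnElt_mul_apply, Fin.cycleRange_self, if_neg k.lt_irrefl, add_zero,
        add_sub_add_left_eq_sub]
      simp [D, ite_sub_ite, sub_mul]
    · simp
  refine ⟨columnElt k c * (columnElt k c')⁻¹, ?_, by group⟩
  have hu : (columnElt k c * (columnElt k c')⁻¹).val - 1 = D := by
    rw [← Units.mul_left_inj (columnElt k c'), hD, sub_mul, one_mul, ← Units.val_mul,
      inv_mul_cancel_right]
  change IsStrictUpperRows h _
  rw [hu]
  intro i j hij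
  refine ite_eq_right_iff.mpr ?_
  rintro ⟨rfl, hik⟩
  exact sub_eq_zero.mpr (hc i (not_lt.mp fun hih => hij ⟨hik, hih⟩) hik)

end ColumnElements

section Stabilizers

variable {n : ℕ} [NeZero n] {F : Type u} [Field F]

theorem columnElt_conj_mem_unipRows_iff {h : ℕ} {k : Fin n} (c : ℕ → F) {g : GL (Fin n) F} :
    columnElt k c * g * (columnElt k c)⁻¹ ∈ unipRows n F h ↔
      ∀ i j : Fin n, ¬ (i < j ∧ i.val < h) →
        g.val (k.cycleRange i) (k.cycleRange j) =
          (1 : Matrix (Fin n) (Fin n) F) (k.cycleRange i) (k.cycleRange j) := by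
  obtain ⟨t, ht, hct⟩ := exists_mem_unipRows_mul_columnElt (h := k.val) k (c := c) (c' := 0)
    fun i hki hik => absurd hki hik.not_ge
  rw [hct, show t * columnElt k 0 * g * (t * columnElt k 0)⁻¹ =
    t * (columnElt k 0 * g * (columnElt k 0)⁻¹) * t⁻¹ by group,
    conj_mem_unipRows_iff ht.blockTriangular, mem_unipRows]
  simp only [columnElt_zero_labels_conj_apply, Matrix.one_apply, EmbeddingLike.apply_eq_iff_eq]

theorem toLevi_apply_eq_one_apply {p : parabolic n F} {i j : Fin n}
    (hp : p.val.val i j = (1 : Matrix (Fin n) (Fin n) F) i j) :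
    (toLevi n F p).val.val i j = (1 : Matrix (Fin n) (Fin n) F) i j := by
  rw [toLevi_apply]
  split_ifs with hij
  · exact hp
  · rw [Matrix.one_apply_ne fun h => hij (by rw [h])]

theorem toLevi_mem_unipRows {h : ℕ} {p : parabolic n F} (hp : p.val ∈ unipRows n F h) :
    (toLevi n F p).val ∈ unipRows n F h :=
  mem_unipRows.mpr fun i j hij => toLevi_apply_eq_one_apply (mem_unipRows.mp hp i j hij)

theorem levi_conj_mem_unipRows_iff {h : ℕ} {k : Fin n} (c : ℕ → F) {l : GL (Fin n) F}
    (hl : l ∈ levi n F) :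
    columnElt k c * l * (columnElt k c)⁻¹ ∈ unipRows n F h ↔
      l ∈ unipRows n F (nextHeight h k) := by
  rw [columnElt_conj_mem_unipRows_iff, mem_unipRows,
    (k.cycleRange.surjective.forall₂ (p := fun x y => ¬ (x < y ∧ x.val < nextHeight h k) →
      l.val x y = (1 : Matrix (Fin n) (Fin n) F) x y))]
  refine forall₂_congr fun i j => ?_
  by_cases hij : k.cycleRange i = 0 ↔ k.cycleRange j = 0
  · obtain rfl | hne := eq_or_ne i j
    · simp
    · refine imp_congr_left (not_congr ?_)
      have hzero (x : Fin n) : k.cycleRange x = 0 ↔ x = k := by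
        rw [← k.cycleRange_self, EmbeddingLike.apply_eq_iff_eq]
      simp only [hzero, Fin.ext_iff, Fin.lt_def, val_cycleRange, Ne, nextHeight] at hij hne ⊢
      split_ifs <;> omega
  · rw [hl _ _ hij, Matrix.one_apply_ne fun h => hij (by rw [h])]
    simp

theorem unip_le_unipRows_nextHeight (h k : ℕ) :
    unip n F ≤ unipRows n F (nextHeight h k) :=
  unipRows_one.symm.trans_le (unipRows_mono (le_max_of_le_right (Nat.le_add_left _ _)))

theorem infConj_columnElt_sup_unip (h : ℕ) (k : Fin n) (c : ℕ → F) :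
    (infConj (parabolic n F) (unipRows n F h) (columnElt k c)).map (parabolic n F).subtype ⊔
      unip n F = unipRows n F (nextHeight h k) := by
  apply le_antisymm
  · refine sup_le ?_ (unip_le_unipRows_nextHeight h k)
    rintro _ ⟨p, hp, rfl⟩
    have hlevi : (toLevi n F p).val ∈ unipRows n F (nextHeight h k) :=
      (levi_conj_mem_unipRows_iff c (toLevi n F p).2).mp <|
        (columnElt_conj_mem_unipRows_iff c).mpr fun i j hij =>
          toLevi_apply_eq_one_apply ((columnElt_conj_mem_unipRows_iff c).mp hp i j hij)
    exact (Subgroup.mul_mem_cancel_left _ ((unipRows n F _).inv_mem hlevi)).mp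
      (unip_le_unipRows_nextHeight h k (toLevi_inv_mul_mem_unip p))
  · intro u hu
    let p : parabolic n F := ⟨u, unipRows_le_parabolic _ hu⟩
    rw [← mul_inv_cancel_left (toLevi n F p).val u]
    exact Subgroup.mul_mem_sup
      ⟨Subgroup.inclusion levi_le_parabolic (toLevi n F p),
        (levi_conj_mem_unipRows_iff c (toLevi n F p).2).mpr (toLevi_mem_unipRows (p := p) hu), rfl⟩
      (toLevi_inv_mul_mem_unip p)

end Stabilizers

/-! ### The double cosets `U_h \ G / P` -/

section DoubleCosets

variable {n : ℕ} {F : Type u} [Field F]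

/-- The vector `(c_0, …, c_{k-1}, 1, 0, …, 0)`. -/
def pivotVec (k : Fin n) (c : ℕ → F) (i : Fin n) : F :=
  if i < k then c i else if i = k then 1 else 0

theorem pivotVec_of_lt {k i : Fin n} (hi : i < k) (c : ℕ → F) : pivotVec k c i = c i :=
  if_pos hi

theorem pivotVec_self (k : Fin n) (c : ℕ → F) : pivotVec k c k = 1 := by
  simp [pivotVec]

theorem pivotVec_of_gt {k i : Fin n} (hi : k < i) (c : ℕ → F) : pivotVec k c i = 0 := by
  rw [pivotVec, if_neg hi.asymm, if_neg hi.ne']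

theorem exists_eq_smul_pivotVec {v : Fin n → F} (hv : v ≠ 0) :
    ∃ (k : Fin n) (c : ℕ → F) (a : F), v = a • pivotVec k c := by
  obtain ⟨k, hk, hmax⟩ := (Set.toFinite {i | v i ≠ 0}).exists_maximalFor id _
    (Function.ne_iff.mp hv)
  refine ⟨k, Function.extend Fin.val ((v k)⁻¹ • v) 0, v k, funext fun i => ?_⟩
  rw [Pi.smul_apply, smul_eq_mul]
  obtain hi | rfl | hi := lt_trichotomy i k
  · rw [pivotVec_of_lt hi, Fin.val_injective.extend_apply, Pi.smul_apply, smul_eq_mul,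
      mul_inv_cancel_left₀ hk]
  · rw [pivotVec_self, mul_one]
  · rw [pivotVec_of_gt hi, mul_zero]
    exact by_contra fun hne => hi.not_ge (hmax hne hi.le)

theorem unipRows_mulVec_apply {h : ℕ} {u : GL (Fin n) F} (hu : u ∈ unipRows n F h)
    {v : Fin n → F} {i : Fin n} (hv : ∀ j, i < j → i.val < h → v j = 0) :
    (u.val.mulVec v) i = v i := by
  rw [Matrix.mulVec, dotProduct, Finset.sum_eq_single i]
  · rw [mem_unipRows.mp hu i i (by simp), Matrix.one_apply_eq, one_mul]
  · intro j _ hj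
    by_cases hij : i < j ∧ i.val < h
    · rw [hv j hij.1 hij.2, mul_zero]
    · rw [mem_unipRows.mp hu i j hij, Matrix.one_apply_ne hj.symm, zero_mul]
  · simp

theorem eq_of_mulVec_pivotVec_eq_smul {h : ℕ} {u : GL (Fin n) F} (hu : u ∈ unipRows n F h)
    {k k' : Fin n} {c c' : ℕ → F} {a : F}
    (heq : u.val.mulVec (pivotVec k c) = a • pivotVec k' c') :
    k = k' ∧ ∀ i : ℕ, h ≤ i → i < k.val → c i = c' i := by
  have entry {i : Fin n} (hi : k ≤ i ∨ h ≤ i.val) : pivotVec k c i = a * pivotVec k' c' i := by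
    rw [← smul_eq_mul, ← Pi.smul_apply, ← heq, unipRows_mulVec_apply hu]
    exact fun j hij hih => pivotVec_of_gt ((hi.resolve_right hih.not_ge).trans_lt hij) c
  have hpivot : a * pivotVec k' c' k = 1 := by rw [← entry (.inl le_rfl), pivotVec_self]
  obtain rfl : k = k' := by
    obtain hlt | rfl | hgt := lt_trichotomy k k'
    · have ha := entry (.inl hlt.le)
      rw [pivotVec_of_gt hlt, pivotVec_self, mul_one] at ha
      rw [← ha, zero_mul] at hpivot
      exact absurd hpivot zero_ne_one
    · rfl
    · rw [pivotVec_of_gt hgt, mul_zero] at hpivot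
      exact absurd hpivot zero_ne_one
  rw [pivotVec_self, mul_one] at hpivot
  refine ⟨rfl, fun i hhi hik => ?_⟩
  have hi := entry (i := ⟨i, hik.trans k.2⟩) (.inr hhi)
  rwa [hpivot, one_mul, pivotVec_of_lt hik, pivotVec_of_lt hik] at hi

/-- The labels of a first column, preceded by zeros for its starred boxes. -/
def FirstColumn.labels {h : ℕ} (c : FirstColumn n F h) : ℕ → F :=
  Function.extend (fun i : Fin (c.1.val - min c.1.val h) => min c.1.val h + i.val) c.2 0

theorem FirstColumn.labels_add {h : ℕ} (c : FirstColumn n F h)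
    (i : Fin (c.1.val - min c.1.val h)) : c.labels (min c.1.val h + i) = c.2 i :=
  Function.Injective.extend_apply (fun _ _ hij => Fin.ext (Nat.add_left_cancel hij)) _ _ _

variable [NeZero n]

theorem col_zero_columnElt (k : Fin n) (c : ℕ → F) : (columnElt k c).val.col 0 = pivotVec k c := by
  ext i
  have hpivot : k.cycleRange i = 0 ↔ i = k := by
    rw [← Fin.cycleRange_self k, EmbeddingLike.apply_eq_iff_eq]
  rw [Matrix.col_apply, ← Matrix.mul_one (columnElt k c).val, columnElt_mul_apply,
    Matrix.one_apply_eq, mul_one, pivotVec]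
  by_cases hi : i < k
  · rw [if_pos hi, if_pos hi, Matrix.one_apply_ne (hpivot.not.mpr hi.ne), zero_add]
  · simp only [if_neg hi, Matrix.one_apply, hpivot, add_zero]

theorem col_zero_mul (x y : GL (Fin n) F) : (x * y).val.col 0 = x.val.mulVec (y.val.col 0) :=
  rfl

theorem col_zero_ne_zero (x : GL (Fin n) F) : x.val.col 0 ≠ 0 := by
  intro hx
  have hone : (1 : GL (Fin n) F).val.col 0 = 0 := by
    rw [← inv_mul_cancel x, col_zero_mul, hx, Matrix.mulVec_zero]
  exact one_ne_zero ((Matrix.one_apply_eq (0 : Fin n)).symm.trans (congrFun hone 0))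

theorem inv_mul_mem_parabolic_iff {x y : GL (Fin n) F} :
    x⁻¹ * y ∈ parabolic n F ↔ ∃ a : F, y.val.col 0 = a • x.val.col 0 := by
  constructor
  · intro hp
    refine ⟨(x⁻¹ * y).val 0 0, funext fun i => ?_⟩
    have hy : y.val = x.val * (x⁻¹ * y).val := by rw [← Units.val_mul, mul_inv_cancel_left]
    have hsum : (x.val * (x⁻¹ * y).val) i 0 = x.val i 0 * (x⁻¹ * y).val 0 0 :=
      Fintype.sum_eq_single (0 : Fin n) fun m hm => mul_eq_zero_of_right _ (hp m hm)
    calc y.val i 0 = x.val i 0 * (x⁻¹ * y).val 0 0 := by rw [← hsum, ← hy]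
      _ = (x⁻¹ * y).val 0 0 * x.val i 0 := mul_comm _ _
  · rintro ⟨a, ha⟩ i hi
    have hcol : (x⁻¹ * y).val.col 0 = a • (1 : GL (Fin n) F).val.col 0 := by
      rw [col_zero_mul, ha, Matrix.mulVec_smul, ← col_zero_mul, inv_mul_cancel]
    calc (x⁻¹ * y).val i 0 = a * (1 : Matrix (Fin n) (Fin n) F) i 0 := congrFun hcol i
      _ = 0 := by rw [Matrix.one_apply_ne hi, mul_zero]

/-- The element `s_k(a_{k-l}) ⋯ s_{l+1}(a_1) s_l(0) ⋯ s_1(0)` attached to a column of height `k`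
with `l` starred boxes and labels `a_1, …, a_{k-l}`. -/
def FirstColumn.rep {h : ℕ} (c : FirstColumn n F h) : GL (Fin n) F := columnElt c.1 c.labels

theorem mk_firstColumn_rep_injective (h : ℕ) :
    Function.Injective fun c : FirstColumn n F h =>
      DoubleCoset.mk (unipRows n F h) (parabolic n F) c.rep := by
  rintro ⟨k, a⟩ ⟨k', a'⟩ hmk
  obtain ⟨u, hu, p, hp, hrep⟩ := (DoubleCoset.eq _ _ _ _).mp hmk
  have hcoset : (FirstColumn.rep ⟨k', a'⟩)⁻¹ * (u * FirstColumn.rep ⟨k, a⟩) ∈ parabolic n F := by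
    rw [hrep, mul_inv_rev, inv_mul_cancel_right]
    exact inv_mem hp
  obtain ⟨t, ht⟩ := inv_mul_mem_parabolic_iff.mp hcoset
  rw [col_zero_mul, FirstColumn.rep, FirstColumn.rep, col_zero_columnElt, col_zero_columnElt] at ht
  obtain ⟨rfl : k = k', hlabels⟩ := eq_of_mulVec_pivotVec_eq_smul hu ht
  refine congrArg (Sigma.mk k) (funext fun i => ?_)
  have hi := hlabels (min k.val h + i) (by omega)
    (Nat.lt_sub_iff_add_lt'.mp i.2)
  rwa [FirstColumn.labels_add ⟨k, a⟩ i, FirstColumn.labels_add ⟨k, a'⟩ i] at hi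

theorem mk_firstColumn_rep_surjective (h : ℕ) :
    Function.Surjective fun c : FirstColumn n F h =>
      DoubleCoset.mk (unipRows n F h) (parabolic n F) c.rep := by
  intro X
  obtain ⟨x, rfl⟩ := Quotient.mk_surjective X
  obtain ⟨k, c, t, ht⟩ := exists_eq_smul_pivotVec (col_zero_ne_zero x)
  rw [← col_zero_columnElt] at ht
  have hp := inv_mul_mem_parabolic_iff.mpr ⟨t, ht⟩
  let C : FirstColumn n F h := ⟨k, fun i => c (min k.val h + i)⟩
  have hlabels (i : ℕ) (hhi : h ≤ i) (hik : i < k.val) : c i = C.labels i := by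
    obtain ⟨j, rfl⟩ := Nat.exists_eq_add_of_le ((min_le_right k.val h).trans hhi)
    exact (C.labels_add ⟨j, Nat.lt_sub_iff_add_lt'.mpr hik⟩).symm
  obtain ⟨u, hu, huC⟩ := exists_mem_unipRows_mul_columnElt k hlabels
  refine ⟨C, (DoubleCoset.eq _ _ _ _).mpr ⟨u, hu, _, hp, ?_⟩⟩
  rw [FirstColumn.rep, ← huC, mul_inv_cancel_left]

theorem bijective_mk_firstColumn_rep (h : ℕ) :
    Function.Bijective fun c : FirstColumn n F h =>
      DoubleCoset.mk (unipRows n F h) (parabolic n F) c.rep :=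
  ⟨mk_firstColumn_rep_injective h, mk_firstColumn_rep_surjective h⟩

theorem exists_mem_unipRows_sProd_mul_sProd_eq {h : ℕ} (c : FirstColumn n F h)
    (b : Fin (min c.1.val h) → F) :
    ∃ u ∈ unipRows n F h, sProd (min c.1.val h) (c.1.val - min c.1.val h) (by omega) c.2 *
      sProd 0 (min c.1.val h) (by omega) b = u * c.rep := by
  let c' : ℕ → F := fun i => if hi : i < min c.1.val h then b ⟨i, hi⟩ else c.labels i
  have hb : b = fun i : Fin _ => c' i := funext fun i => by
    rw [show c' i = _ from dif_pos i.2]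
  have ha : c.2 = fun i : Fin _ => c' (min c.1.val h + i) := funext fun i =>
    ((dif_neg (by omega)).trans (c.labels_add i)).symm
  rw [hb, ha, sProd_mul_sProd_zero (k := c.1) (by omega)]
  exact exists_mem_unipRows_mul_columnElt c.1 fun i hhi _ => dif_neg (by omega)

end DoubleCosets

/-! ### The bases `(v_K)` -/

section Bases

variable {n : ℕ} [NeZero n] {F : Type u} [Field F]

theorem algTmul_of (V : Rep.{u} ℂ (levi n F)) (g : GL (Fin n) F) (v : V) :
    algTmul V (MonoidAlgebra.of ℂ _ g) v = groupTmul V g v :=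
  (Finsupp.sum_single_index (zero_smul ℂ (groupTmul V g v))).trans
    (one_smul ℂ (groupTmul V g v))

theorem algTmul_of_mul_smul_sum (V : Rep.{u} ℂ (levi n F)) {ι : Type*} [Fintype ι]
    (x : GL (Fin n) F) (y : ι → GL (Fin n) F) (t : ℂ) (v : V) :
    algTmul V (MonoidAlgebra.of ℂ _ x * (t • ∑ i, MonoidAlgebra.of ℂ _ (y i))) v =
      t • ∑ i, groupTmul V (x * y i) v := by
  let T : MonoidAlgebra ℂ (GL (Fin n) F) →ₗ[ℂ] Indf V :=
    Finsupp.linearCombination ℂ (fun g => groupTmul V g v) ∘ₗ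
      (MonoidAlgebra.coeffLinearEquiv ℂ).toLinearMap
  have hT (g : GL (Fin n) F) : T (MonoidAlgebra.of ℂ _ g) = groupTmul V g v := algTmul_of V g v
  change T _ = _
  simp only [mul_smul_comm, Finset.mul_sum, ← map_mul, map_smul, map_sum, hT]

variable [Fintype F]

theorem average_algTmul_starW (V : Rep.{u} ℂ (levi n F)) {h : ℕ} (c : FirstColumn n F h) (v : V) :
    average (Indf V).ρ (unipRows n F h)
        (algTmul V (starW c.1 (min c.1.val h) (min_le_left _ _) c.2) v) =
      average (Indf V).ρ (unipRows n F h) (groupTmul V c.rep v) := by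
  have hterm (b : Fin (min c.1.val h) → F) :
      average (Indf V).ρ (unipRows n F h) (groupTmul V
        (sProd (min c.1.val h) (c.1.val - min c.1.val h) (by omega) c.2 *
          sProd 0 (min c.1.val h) (by omega) b) v) =
        average (Indf V).ρ (unipRows n F h) (groupTmul V c.rep v) := by
    obtain ⟨u, hu, hub⟩ := exists_mem_unipRows_sProd_mul_sProd_eq c b
    rw [hub]
    exact average_indTmul_mul (Infl V).ρ _ hu _ v
  have hcard : (Fintype.card F : ℂ) ^ min c.1.val h ≠ 0 :=
    pow_ne_zero _ (Nat.cast_ne_zero.mpr Fintype.card_ne_zero)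
  rw [starW, algTmul_of_mul_smul_sum, map_smul, map_sum, Finset.sum_congr rfl fun b _ => hterm b,
    Finset.sum_const, Finset.card_univ, Fintype.card_fun, Fintype.card_fin,
    ← Nat.cast_smul_eq_nsmul ℂ, Nat.cast_pow, inv_smul_smul₀ hcard]

theorem toResf_apply_parabolic (V : Rep.{u} ℂ (GL (Fin n) F)) (p : parabolic n F) (v : V) :
    toResf V (V.ρ p.val v) = (Resf V).ρ (toLevi n F p) (toResf V v) := by
  have levi_comm (l : levi n F) (x : V) :
      toResf V (V.ρ l.val x) = (Resf V).ρ l (toResf V x) := Subtype.ext (eUOp_comm V l x).symm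
  rw [← mul_inv_cancel_left (toLevi n F p).val p.val, map_mul, Module.End.mul_apply, levi_comm]
  refine congrArg _ (resfSubtype_injective V ?_)
  rw [resfSubtype_toResf, resfSubtype_toResf, average_smul _ (toLevi_inv_mul_mem_unip p)]

theorem average_groupTmul_toResf_average (V : Rep.{u} ℂ (GL (Fin n) F)) {h : ℕ}
    (c : FirstColumn n F h) (v : V) :
    average (Indf (Resf V)).ρ (unipRows n F h) (groupTmul (Resf V) c.rep
        (toResf V (average V.ρ (unipRows n F (nextHeight h c.1)) v))) =
      average (Indf (Resf V)).ρ (unipRows n F h)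
        (groupTmul (Resf V) c.rep (toResf V v)) := by
  refine apply_average_of_forall (average (Indf (Resf V)).ρ (unipRows n F h) ∘ₗ
    groupTmul (Resf V) c.rep ∘ₗ toResf V) fun w hw => ?_
  let p : parabolic n F := ⟨w, unipRows_le_parabolic _ hw⟩
  let l : levi n F := toLevi n F p
  have hconj : c.rep * l.val * c.rep⁻¹ ∈ unipRows n F h :=
    (levi_conj_mem_unipRows_iff c.labels l.2).mpr (toLevi_mem_unipRows (p := p) hw)
  have hmove : groupTmul (Resf V) c.rep (toResf V (V.ρ w v)) =
      groupTmul (Resf V) (c.rep * l.val * c.rep⁻¹ * c.rep) (toResf V v) := by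
    have hmul := groupTmul_mul (Resf V) c.rep (Subgroup.inclusion levi_le_parabolic l) (toResf V v)
    rw [toLevi_inclusion] at hmul
    rw [inv_mul_cancel_right, toResf_apply_parabolic V p]
    exact hmul.symm
  simp only [LinearMap.comp_apply, hmove]
  exact average_indTmul_mul (Infl (Resf V)).ρ _ hconj _ _

/-- The identification of the `U_{h'}`-fixed vectors of `V`, where `h' = max h (min k h + 1)`, with
the vectors of `e_U V` fixed by `P ∩ w⁻¹ U_h w`, where `w` is the representative of a column of
height `k`. -/
def fixedEquivResf (V : Rep.{u} ℂ (GL (Fin n) F)) {h : ℕ} (c : FirstColumn n F h) :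
    fixedVectors V.ρ (unipRows n F (nextHeight h c.1)) ≃ₗ[ℂ]
      fixedVectors (inflResf V) (infConj (parabolic n F) (unipRows n F h) c.rep) :=
  LinearEquiv.ofEq _ _ (congrArg (fixedVectors V.ρ)
    (infConj_columnElt_sup_unip h c.1 c.labels).symm) ≪≫ₗ (resfFixedEquiv V _).symm

theorem fixedEquivResf_apply (V : Rep.{u} ℂ (GL (Fin n) F)) {h : ℕ} (c : FirstColumn n F h)
    (v : fixedVectors V.ρ (unipRows n F (nextHeight h c.1))) :
    (fixedEquivResf V c v : Resf V) = toResf V v := by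
  have hv : v.val ∈ fixedVectors V.ρ (unip n F) := mem_fixedVectors.mpr fun u hu =>
    mem_fixedVectors.mp v.2 u (unip_le_unipRows_nextHeight h c.1 hu)
  refine resfSubtype_injective V ((resfSubtype_resfFixedEquiv_symm V _ _).trans ?_)
  rw [resfSubtype_toResf, average_of_mem_fixedVectors _ hv]
  rfl

theorem fixedVectors_IR_zero (H : Subgroup (GL (Fin n) F)) :
    fixedVectors (IR n F 0).ρ H = ⊤ :=
  eq_top_iff.mpr fun _ _ => mem_fixedVectors.mpr fun _ _ => rfl

/-- The basis of the `U_h`-fixed vectors of `IR^r` formed by the averages over `U_h` of the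
vectors `v_K`, where `K` has initial `∗`-height `h`; see `fixedBasis_apply`. -/
def fixedBasis : (r h : ℕ) → Module.Basis (QSetPartitionFrom n F r h) ℂ
    (fixedVectors (IR n F r).ρ (unipRows n F h))
  | 0, h => (Module.Basis.singleton (QSetPartitionFrom n F 0 h) ℂ).map
      (ULift.moduleEquiv.symm ≪≫ₗ (LinearEquiv.ofTop _ (fixedVectors_IR_zero _)).symm)
  | r + 1, h => (mackeyBasis (inflResf (IR n F r)) (unipRows n F h)
      (bijective_mk_firstColumn_rep h) fun c =>
        (fixedBasis r (nextHeight h c.1)).map (fixedEquivResf (IR n F r) c)).reindex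
    (QSetPartitionFrom.consEquiv n F r h)

theorem fixedBasis_apply (r h : ℕ) (K : QSetPartitionFrom n F r h) :
    (fixedBasis r h K : IR n F r) =
      average (IR n F r).ρ (unipRows n F h) (iterTmul r K.column) := by
  induction r generalizing h with
  | zero =>
    rw [average_of_mem_fixedVectors _ (fixedVectors_IR_zero (unipRows n F h) ▸ trivial), fixedBasis,
      Module.Basis.map_apply, Module.Basis.singleton_apply]
    rfl
  | succ r ih =>
    obtain ⟨⟨c, K⟩, rfl⟩ := (QSetPartitionFrom.consEquiv n F r h).surjective K
    have hreindex := Module.Basis.reindex_apply (mackeyBasis (inflResf (IR n F r))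
      (unipRows n F h) (bijective_mk_firstColumn_rep h) fun c =>
        (fixedBasis r (nextHeight h c.1)).map (fixedEquivResf (IR n F r) c))
      (QSetPartitionFrom.consEquiv n F r h) (QSetPartitionFrom.consEquiv n F r h ⟨c, K⟩)
    rw [Equiv.symm_apply_apply] at hreindex
    refine (congrArg Subtype.val hreindex).trans ((mackeyBasis_apply _ _ _ _ _ _).trans ?_)
    rw [Module.Basis.map_apply, fixedEquivResf_apply, ih]
    exact (average_groupTmul_toResf_average _ c _).trans (average_algTmul_starW _ c _).symm

/-- The basis of `IR^r` formed by the vectors `v_K`. -/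
def basisIR (n : ℕ) [NeZero n] (F : Type u) [Field F] [Fintype F] (r : ℕ) :
    Module.Basis (QSetPartition n r F) ℂ (IR n F r) :=
  ((fixedBasis r 0).map (LinearEquiv.ofTop _ (by rw [unipRows_zero, fixedVectors_bot]))).reindex
    (QSetPartitionFrom.equivZero n r F)

theorem basisIR_apply (r : ℕ) (K : QSetPartition n r F) : basisIR n F r K = vec K := by
  obtain ⟨K, rfl⟩ := (QSetPartitionFrom.equivZero n r F).surjective K
  rw [basisIR, Module.Basis.reindex_apply, Equiv.symm_apply_apply, vec,
    QSetPartitionFrom.column_equivZero]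
  refine (fixedBasis_apply r 0 K).trans (average_of_mem_fixedVectors _ ?_)
  rw [unipRows_zero, fixedVectors_bot]
  trivial

/-- The identification of the `U`-fixed vectors of `IR^r` with `IR^{r+1/2}`. -/
def fixedEquivIRHalf (n : ℕ) [NeZero n] (F : Type u) [Field F] [Fintype F] (r : ℕ) :
    fixedVectors (IR n F r).ρ (unipRows n F 1) ≃ₗ[ℂ] IRHalf n F r :=
  LinearEquiv.ofEq _ (LinearMap.range (eUOp (IR n F r)))
    (by rw [unipRows_one, eUOp_eq_average, range_average])

/-- The basis of `IR^{r+1/2}` formed by the vectors `v_K` with `k_1 = 0`. -/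
def basisIRHalf (n : ℕ) [NeZero n] (F : Type u) [Field F] [Fintype F] (r : ℕ) :
    Module.Basis {K : QSetPartition n (r + 1) F // K.k 0 = 0} ℂ (IRHalf n F r) :=
  ((fixedBasis r 1).map (fixedEquivIRHalf n F r)).reindex
    (QSetPartitionFrom.equivOne n r F)

theorem basisIRHalf_apply (r : ℕ) (K : {K : QSetPartition n (r + 1) F // K.k 0 = 0}) :
    basisIRHalf n F r K = vecHalf K.val := by
  obtain ⟨K, rfl⟩ := (QSetPartitionFrom.equivOne n r F).surjective K
  rw [basisIRHalf, Module.Basis.reindex_apply, Equiv.symm_apply_apply, Module.Basis.map_apply,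
    vecHalf, QSetPartitionFrom.tail_column_equivOne]
  refine resfSubtype_injective _ ((fixedBasis_apply r 1 K).trans ?_)
  rw [resfSubtype_toResf, average_congr _ unipRows_one]

theorem halfIncl_vecHalf (r : ℕ) {K : QSetPartition n (r + 1) F} (hK : K.k 0 = 0) :
    halfIncl r (vecHalf K) = vec K := by
  obtain ⟨K', hK'⟩ := (QSetPartitionFrom.equivOne n r F).surjective ⟨K, hK⟩
  have hcolumn := QSetPartitionFrom.column_zero_equivOne K'
  rw [hK', ← map_one (MonoidAlgebra.of ℂ (GL (Fin n) F))] at hcolumn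
  rw [vec, iterTmul, hcolumn, algTmul_of]
  rfl

theorem finrank_IR (r : ℕ) : Module.finrank ℂ (IR n F r) = d n r (Fintype.card F) := by
  rw [Module.finrank_eq_nat_card_basis (basisIR n F r),
    ← Nat.card_congr (QSetPartitionFrom.equivZero n r F), QSetPartitionFrom.card_zero]

theorem qInt_mul_finrank_IRHalf (r : ℕ) :
    qInt (Fintype.card F) n * Module.finrank ℂ (IRHalf n F r) =
      d n (r + 1) (Fintype.card F) := by
  rw [Module.finrank_eq_nat_card_basis (basisIRHalf n F r),
    ← Nat.card_congr (QSetPartitionFrom.equivOne n r F), QSetPartitionFrom.qInt_mul_card_one]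

end Bases

end QPartition

end

theorem mainTheorem5 {F : Type*} [Field F] [Fintype F] (n : ℕ) [NeZero n] (r : ℕ) :
    ((∃ b : Module.Basis (QPartition.QSetPartition n r F) ℂ (QPartition.IR n F r),
        ∀ K, b K = QPartition.vec K) ∧
      Module.finrank ℂ (QPartition.IR n F r) = QPartition.d n r (Fintype.card F)) ∧
    ((Function.Injective (QPartition.halfIncl (n := n) (F := F) r) ∧
        ∃ b : Module.Basis {K : QPartition.QSetPartition n (r + 1) F // K.k 0 = 0} ℂ
            (QPartition.IRHalf n F r),
          ∀ K, b K = QPartition.vecHalf K.val ∧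
            QPartition.halfIncl r (b K) = QPartition.vec K.val) ∧
      (Module.finrank ℂ (QPartition.IRHalf n F r) : ℚ) =
        (QPartition.d n (r + 1) (Fintype.card F) : ℚ) /
          (QPartition.qInt (Fintype.card F) n : ℚ)) := by
  refine ⟨⟨⟨QPartition.basisIR n F r, QPartition.basisIR_apply r⟩, QPartition.finrank_IR r⟩,
    ⟨QPartition.groupTmul_one_injective _, QPartition.basisIRHalf n F r, fun K =>
      ⟨QPartition.basisIRHalf_apply r K, ?_⟩⟩, ?_⟩
  · rw [QPartition.basisIRHalf_apply, QPartition.halfIncl_vecHalf r K.2]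
  · have qInt_ne_zero : (QPartition.qInt (Fintype.card F) n : ℚ) ≠ 0 :=
      Nat.cast_ne_zero.mpr (QPartition.qInt_pos _ (NeZero.ne n)).ne'
    rw [eq_div_iff qInt_ne_zero, ← QPartition.qInt_mul_finrank_IRHalf, Nat.cast_mul, mul_comm]
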